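/- Let $d\in\{2,3\}$, let $\Omega\subset\mathbb{R}^d$ be a bounded domain (nonempty, open, connected) with $0\in\Omega$ and $\mathbb{R}^d\setminus\overline{\Omega}$ connected, and let $\mathbb{M}\subset\mathbb{R}^d\setminus\overline{\Omega}$ be a bounded domain. Let $k>0$, let $\mathbf{m}\in\mathbb{R}^d$ with $|\mathbf{m}|<1$, and put $\beta^2=1-|\mathbf{m}|^2$, $\beta>0$, $|\mathbf{x}|_{\mathbf{m}}=\sqrt{(\mathbf{x}\cdot\mathbf{m})^2+\beta^2|\mathbf{x}|^2}$, $\mathbf{A}=\mathbf{m}\mathbf{m}^\top+\beta^2\mathbf{I}$ and $\mathbb{S}_{d-1}(\mathbf{m})=\{\mathbf{x}\in\mathbb{R}^d:|\mathbf{x}|_{\mathbf{m}}=1\}$. Let $g$ be the free-field Green's function of the convected Helmholtz equation $(k+i\mathbf{m}\cdot\nabla)^2p+\Delta p=-Q$, that is, \[ g(\mathbf{x},\mathbf{y})=\frac{i}{4\beta}\exp\Big(-\frac{ik}{\beta^2}(\mathbf{x}-\mathbf{y})\cdot\mathbf{m}\Big)H_0^{(1)}\Big(\frac{k}{\beta^2}|\mathbf{x}-\mathbf{y}|_{\mathbf{m}}\Big)\quad(d=2),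 \] \[ g(\mathbf{x},\mathbf{y})=\frac{\exp\big(\frac{ik}{\beta^2}(-(\mathbf{x}-\mathbf{y})\cdot\mathbf{m}+|\mathbf{x}-\mathbf{y}|_{\mathbf{m}})\big)}{4\pi|\mathbf{x}-\mathbf{y}|_{\mathbf{m}}}\quad(d=3), \] where $H_0^{(1)}=J_0+iY_0$ is the Hankel function of the first kind of order $0$. Then the volume potential \[ (\mathcal{G}v)(\mathbf{x})=\int_\Omega g(\mathbf{x},\mathbf{y})v(\mathbf{y})\,d\mathbf{y},\qquad \mathbf{x}\in\mathbb{M}, \] defines a bounded linear operator $\mathcal{G}:L^2(\Omega)\to L^2(\mathbb{M})$ (complex-valued functions), and for every $\hat{\mathbf{x}}\in\mathbb{S}_{d-1}(\mathbf{m})$ the plane wave \[ u_{\mathbf{m},\hat{\mathbf{x}}}(\mathbf{y})=\exp\Big(\frac{ik}{\beta^2}(\mathbf{A}\hat{\mathbf{x}}-\mathbf{m})\cdot\mathbf{y}\Big),\qquad\mathbf{y}\in\Omega, \] belongs to the closure in $L^2(\Omega)$ of the range $\operatorname{ran}(\mathcal{G}^*)$ of the adjoint of $\mathcal{G}$; equivalently,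 $u_{\mathbf{m},\hat{\mathbf{x}}}\in\ker(\mathcal{G})^{\perp}$. -/

import Mathlib

open MeasureTheory

noncomputable section

namespace ConvectedHelmholtz

/-- The Bessel function `J₀`, by its power series. -/
def besselJ0 (t : ℝ) : ℝ :=
  ∑' j : ℕ, (-1 : ℝ) ^ j / (j.factorial : ℝ) ^ 2 * (t / 2) ^ (2 * j)

/-- The Bessel function of the second kind (Neumann function) `Y₀` on `t > 0`:
`Y₀(t) = (2/π) (log (t/2) + γ) J₀(t) - (2/π) ∑ⱼ (-1)ʲ Hⱼ / (j!)² (t/2)²ʲ`, where `γ` is Euler's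
constant and `Hⱼ = 1 + 1/2 + ⋯ + 1/j` (`H₀ = 0`). -/
def besselY0 (t : ℝ) : ℝ :=
  2 / Real.pi * (Real.log (t / 2) + Real.eulerMascheroniConstant) * besselJ0 t
    - 2 / Real.pi *
      ∑' j : ℕ, (-1 : ℝ) ^ j * ((harmonic j : ℚ) : ℝ) / (j.factorial : ℝ) ^ 2 * (t / 2) ^ (2 * j)

/-- The Hankel function of the first kind of order zero, `H₀⁽¹⁾ = J₀ + i Y₀`. -/
def hankel0 (t : ℝ) : ℂ := (besselJ0 t : ℂ) + Complex.I * (besselY0 t : ℂ)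

/-- `β² = 1 - |m|²`. -/
def betaSq {d : ℕ} (m : EuclideanSpace ℝ (Fin d)) : ℝ := 1 - ‖m‖ ^ 2

/-- The Mach norm `|x|_m = √((x·m)² + β² |x|²)`. -/
def machNorm {d : ℕ} (m x : EuclideanSpace ℝ (Fin d)) : ℝ :=
  Real.sqrt (inner ℝ x m ^ 2 + betaSq m * ‖x‖ ^ 2)

/-- The unit sphere of the Mach norm. -/
def machSphere {d : ℕ} (m : EuclideanSpace ℝ (Fin d)) : Set (EuclideanSpace ℝ (Fin d)) :=
  {x | machNorm m x = 1}

/-- The matrix `A = m mᵀ + β² I`, applied to the vector `x`. -/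
def machA {d : ℕ} (m x : EuclideanSpace ℝ (Fin d)) : EuclideanSpace ℝ (Fin d) :=
  inner ℝ m x • m + betaSq m • x

/-- The free-field Green's function of the convected Helmholtz equation
`(k + i m·∇)² p + Δ p = -Q` in dimension two. -/
def green2 {d : ℕ} (k : ℝ) (m x y : EuclideanSpace ℝ (Fin d)) : ℂ :=
  Complex.I / (4 * (Real.sqrt (betaSq m) : ℂ))
    * Complex.exp (-(Complex.I * (k / betaSq m * inner ℝ (x - y) m : ℝ)))
    * hankel0 (k / betaSq m * machNorm m (x - y))

/-- The free-field Green's function of the convected Helmholtz equation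
`(k + i m·∇)² p + Δ p = -Q` in dimension three. -/
def green3 {d : ℕ} (k : ℝ) (m x y : EuclideanSpace ℝ (Fin d)) : ℂ :=
  Complex.exp (Complex.I * (k / betaSq m * (-inner ℝ (x - y) m + machNorm m (x - y)) : ℝ))
    / (4 * (Real.pi : ℂ) * (machNorm m (x - y) : ℂ))

/-- The free-field Green's function `g(x, y)`; only the dimensions `d = 2` and `d = 3` are used. -/
def green {d : ℕ} (k : ℝ) (m x y : EuclideanSpace ℝ (Fin d)) : ℂ :=
  if d = 2 then green2 k m x y else green3 k m x y

/-- The space `L²(U)` of complex-valued functions, `U ⊆ ℝᵈ` with Lebesgue measure. -/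
abbrev L2 {d : ℕ} (U : Set (EuclideanSpace ℝ (Fin d))) : Type :=
  Lp ℂ 2 (volume.restrict U)

/-- `G : L²(Ω) → L²(M)` is the volume potential operator `(G v)(x) = ∫_Ω g(x, y) v(y) dy`,
`x ∈ M`, the integral being absolutely convergent. -/
def IsVolumePotentialOperator {d : ℕ} (k : ℝ) (m : EuclideanSpace ℝ (Fin d))
    (Ω M : Set (EuclideanSpace ℝ (Fin d))) (G : L2 Ω →L[ℂ] L2 M) : Prop :=
  ∀ v : L2 Ω, ∀ᵐ x ∂(volume.restrict M),
    Integrable (fun y => green k m x y * v y) (volume.restrict Ω) ∧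
      G v x = ∫ y in Ω, green k m x y * v y

/-- The plane wave `u_{m,x̂}(y) = exp((ik/β²) (A x̂ - m)·y)`. -/
def planeWave {d : ℕ} (k : ℝ) (m xhat y : EuclideanSpace ℝ (Fin d)) : ℂ :=
  Complex.exp (Complex.I * (k / betaSq m * inner ℝ (machA m xhat - m) y : ℝ))

end ConvectedHelmholtz

end

/-! Since the closure of the range of `G*` is the orthogonal complement of `ker G`, it suffices that
`G v = 0` forces `v` to be orthogonal to every plane wave. Write κ = k/β². Up to a nonzero constant,
Green's function is `exp(-iκ (x - y)·m) F(|x - y|_m²)`, where `F` is a radial profile of the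
Helmholtz equation (`exists_green_eq`). The exponential factors: the x-part never vanishes, and the
y-part is absorbed into the density `w = exp(iκ m·y) v`. So `G v = 0` says that the potential of `w`
with kernel `F(|x - y|_m²)` vanishes almost everywhere on M.

Outside the closure of Ω this potential is real analytic along segments, because `F` is holomorphic
on the slit plane. Connectedness of the exterior therefore propagates the zero from M to the whole
exterior (`IsRadialProfile.potential_eq_zero`).

The plane waves are reached by a cut-off instead of far-field asymptotics. The wave `exp(-iκ (A
x̂)·y)` solves the homogeneous equation `convOp = 0`. Multiplied by a bump function equal to one
around the closure of Ω, it becomes a test function φ, and `convOp φ` lives on a compact set S in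
the exterior. As `F(|x - y|_m²)` is a nonzero multiple of a fundamental solution
(`IsRadialProfile.exists_integral_eq`), on Ω the wave is a superposition of kernels `F(|x - y|_m²)`
with x in S. Fubini turns its pairing with `w` into an integral over S of the potential of `w`,
which is zero (`IsRadialProfile.integral_machWave_eq_zero`).

Boundedness of `G` is a Cauchy–Schwarz estimate: the kernel has a locally square integrable
convolution majorant, and M has finite measure (`exists_integralOperator`). -/

namespace ConvectedHelmholtz

open Filter Topology Complex
open scoped ContDiff

/-! ### Entire power series and the Bessel equation -/

/-- An entire power series may be differentiated term by term. -/
theorem hasDerivAt_tsum_mul_pow {a : ℕ → ℂ} (ha : ∀ r : ℝ, 0 ≤ r → Summable fun n => ‖a n‖ * r ^ n)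
    (z : ℂ) :
    HasDerivAt (fun z => ∑' n, a n * z ^ n) (∑' n : ℕ, ((n + 1 : ℕ) * a (n + 1)) * z ^ n) z := by
  set R : ℝ := ‖z‖ + 1 with hR
  have hR1 : 1 ≤ R := by rw [hR]; linarith [norm_nonneg z]
  have hu : Summable fun n : ℕ => ‖a n‖ * (n * R ^ (n - 1)) := by
    -- Since n ≤ 2ⁿ and R ≥ 1, the differentiated series at radius R is dominated by the original
    -- one at 2R.
    refine Summable.of_nonneg_of_le (fun n => by positivity) (fun n => ?_) (ha (2 * R) (by positivity))
    have h1 : (n : ℝ) ≤ 2 ^ n := by exact_mod_cast n.lt_two_pow_self.le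
    have h2 : R ^ (n - 1) ≤ R ^ n := pow_le_pow_right₀ hR1 (Nat.sub_le _ _)
    rw [mul_pow]
    gcongr
  have hbd : ∀ (n : ℕ) (y : ℂ), y ∈ Metric.ball (0 : ℂ) R →
      ‖a n * (n * y ^ (n - 1))‖ ≤ ‖a n‖ * (n * R ^ (n - 1)) := by
    intro n y hy
    rw [mem_ball_zero_iff] at hy
    rw [norm_mul, norm_mul, norm_pow, Complex.norm_natCast]
    gcongr
  have hz : z ∈ Metric.ball (0 : ℂ) R := by rw [mem_ball_zero_iff]; linarith
  have key := hasDerivAt_tsum_of_isPreconnected (g := fun (n : ℕ) (z : ℂ) => a n * z ^ n)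
    (g' := fun n y => a n * (n * y ^ (n - 1))) (y₀ := (0 : ℂ)) hu Metric.isOpen_ball
    (convex_ball (0 : ℂ) R).isPreconnected
    (fun n y _ => (hasDerivAt_pow n y).const_mul (a n)) hbd
    (Metric.mem_ball_self (by linarith))
    (by
      refine Summable.of_norm ?_
      simpa [norm_mul, norm_pow] using ha 0 le_rfl) hz
  have hs : Summable fun n : ℕ => a n * (n * z ^ (n - 1)) :=
    Summable.of_norm_bounded hu (fun n => hbd n z hz)
  have he : ∑' n : ℕ, ((n + 1 : ℕ) * a (n + 1)) * z ^ n = ∑' n : ℕ, a n * (n * z ^ (n - 1)) := by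
    rw [hs.tsum_eq_zero_add]
    simp only [Nat.cast_zero, zero_mul, mul_zero, zero_add, Nat.add_sub_cancel]
    exact tsum_congr fun n => by ring
  rw [he]
  exact key

/-- Because n + 1 ≤ 2ⁿ⁺¹, differentiation preserves the infinite radius of convergence, so
term-by-term differentiation can be iterated. -/
theorem summable_norm_succ_mul_pow {a : ℕ → ℂ}
    (ha : ∀ r : ℝ, 0 ≤ r → Summable fun n => ‖a n‖ * r ^ n) (r : ℝ) (hr : 0 ≤ r) :
    Summable fun n : ℕ => ‖((n + 1 : ℕ) : ℂ) * a (n + 1)‖ * r ^ n := by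
  have h := (summable_nat_add_iff 1).2 (ha (2 * (r + 1)) (by positivity))
  refine Summable.of_nonneg_of_le (fun n => by positivity) (fun n => ?_) h
  have h1 : ((n + 1 : ℕ) : ℝ) ≤ 2 ^ (n + 1) := by exact_mod_cast (n + 1).lt_two_pow_self.le
  have h2 : r ^ n ≤ (r + 1) ^ (n + 1) :=
    (pow_le_pow_left₀ hr (by linarith) n).trans (pow_le_pow_right₀ (by linarith) n.le_succ)
  rw [norm_mul, Complex.norm_natCast, mul_pow]
  calc _ = ‖a (n + 1)‖ * (((n + 1 : ℕ) : ℝ) * r ^ n) := by ring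
    _ ≤ _ := by gcongr

theorem summable_mul_pow {a : ℕ → ℂ}
    (ha : ∀ r : ℝ, 0 ≤ r → Summable fun n => ‖a n‖ * r ^ n) (z : ℂ) :
    Summable fun n => a n * z ^ n :=
  Summable.of_norm (by simpa [norm_mul, norm_pow] using ha ‖z‖ (norm_nonneg z))

/-- The coefficients `(-1)ⁿ / (n!)²` of `J₀(2√z)`. -/
noncomputable def besselCoeff (n : ℕ) : ℂ := (-1) ^ n / (n.factorial : ℂ) ^ 2

/-- The coefficients `(-1)ⁿ Hₙ / (n!)²` of the power series in `Y₀(2√z)`. -/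
noncomputable def neumannCoeff (n : ℕ) : ℂ := (-1) ^ n * ((harmonic n : ℚ) : ℂ) / (n.factorial : ℂ) ^ 2

/-- Coefficient form of `z j'' + j' + j = 0`, which is Bessel's equation of order zero in the
variable z = t²/4. -/
theorem besselCoeff_succ (n : ℕ) :
    ((n + 1 : ℕ) : ℂ) * (((n + 1 : ℕ) : ℂ) * besselCoeff (n + 1)) = -besselCoeff n := by
  have h1 : ((n.factorial : ℕ) : ℂ) ≠ 0 := by exact_mod_cast n.factorial_ne_zero
  have h2 : ((n + 1 : ℕ) : ℂ) ≠ 0 := by exact_mod_cast n.succ_ne_zero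
  rw [besselCoeff, besselCoeff, Nat.factorial_succ, Nat.cast_mul]
  field_simp
  ring

theorem neumannCoeff_eq (n : ℕ) : neumannCoeff n = besselCoeff n * ((harmonic n : ℚ) : ℂ) := by
  rw [neumannCoeff, besselCoeff]; ring

/-- From `Hₙ₊₁ = Hₙ + 1/(n+1)`: the extra summand is the n-th coefficient of `j'`, the inhomogeneity
that will cancel what the logarithm in Y₀ produces. -/
theorem neumannCoeff_succ (n : ℕ) :
    ((n + 1 : ℕ) : ℂ) * (((n + 1 : ℕ) : ℂ) * neumannCoeff (n + 1))
      = -neumannCoeff n + ((n + 1 : ℕ) : ℂ) * besselCoeff (n + 1) := by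
  have h2 : ((n + 1 : ℕ) : ℂ) ≠ 0 := by exact_mod_cast n.succ_ne_zero
  have h := besselCoeff_succ n
  have h3 : besselCoeff n = -(((n + 1 : ℕ) : ℂ) * (((n + 1 : ℕ) : ℂ) * besselCoeff (n + 1))) := by
    rw [h]; ring
  rw [neumannCoeff_eq, neumannCoeff_eq, harmonic_succ, h3, Rat.cast_add, Rat.cast_inv,
    Rat.cast_natCast]
  field_simp

theorem norm_harmonic_le (n : ℕ) : ‖((harmonic n : ℚ) : ℂ)‖ ≤ 2 ^ n := by
  have h0 : ∀ n : ℕ, (0 : ℚ) ≤ harmonic n ∧ harmonic n ≤ n := by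
    intro n
    induction n with
    | zero => simp
    | succ n ih =>
      rw [harmonic_succ]
      have : ((n + 1 : ℕ) : ℚ)⁻¹ ≤ 1 := inv_le_one_of_one_le₀ (by exact_mod_cast Nat.le_add_left 1 n)
      refine ⟨add_nonneg ih.1 (by positivity), ?_⟩
      push_cast at this ⊢
      linarith [ih.2]
  have h1 : ‖((harmonic n : ℚ) : ℂ)‖ = ((harmonic n : ℚ) : ℝ) := by
    rw [← Complex.ofReal_ratCast, Complex.norm_real, Real.norm_of_nonneg]
    exact_mod_cast (h0 n).1
  rw [h1]
  have h2 : ((harmonic n : ℚ) : ℝ) ≤ n := by exact_mod_cast (h0 n).2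
  exact h2.trans (by exact_mod_cast n.lt_two_pow_self.le)

theorem norm_besselCoeff_le (n : ℕ) : ‖besselCoeff n‖ ≤ 1 / (n.factorial : ℝ) := by
  have h : (1 : ℝ) ≤ n.factorial := by exact_mod_cast n.factorial_pos
  rw [besselCoeff, norm_div, norm_pow, norm_pow, norm_neg, norm_one, one_pow, Complex.norm_natCast]
  exact one_div_le_one_div_of_le (by positivity) (by nlinarith)

theorem summable_besselCoeff (r : ℝ) (hr : 0 ≤ r) : Summable fun n => ‖besselCoeff n‖ * r ^ n := by
  refine Summable.of_nonneg_of_le (fun n => by positivity) (fun n => ?_)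
    (Real.summable_pow_div_factorial r)
  calc _ ≤ 1 / (n.factorial : ℝ) * r ^ n := by gcongr; exact norm_besselCoeff_le n
    _ = _ := by ring

theorem summable_neumannCoeff (r : ℝ) (hr : 0 ≤ r) :
    Summable fun n => ‖neumannCoeff n‖ * r ^ n := by
  refine Summable.of_nonneg_of_le (fun n => by positivity) (fun n => ?_)
    (Real.summable_pow_div_factorial (2 * r))
  rw [neumannCoeff_eq, norm_mul]
  calc _ ≤ 1 / (n.factorial : ℝ) * 2 ^ n * r ^ n := by
        gcongr
        · exact norm_besselCoeff_le n
        · exact norm_harmonic_le n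
    _ = _ := by rw [mul_pow]; ring

/-- Entire functions `j`, `h` with `J₀(t) = j (t²/4)`, and with
`Y₀(t) = (2/π) ((log (t/2) + γ) j (t²/4) - h (t²/4))`, and the equations they satisfy. -/
theorem exists_bessel_entire :
    ∃ j j1 j2 h h1 h2 : ℂ → ℂ,
      (∀ z, HasDerivAt j (j1 z) z) ∧ (∀ z, HasDerivAt j1 (j2 z) z) ∧
      (∀ z, HasDerivAt h (h1 z) z) ∧ (∀ z, HasDerivAt h1 (h2 z) z) ∧
      (∀ z, z * j2 z + j1 z + j z = 0) ∧ (∀ z, z * h2 z + h1 z + h z = j1 z) ∧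
      Continuous j2 ∧ Continuous h2 ∧ j 0 = 1 ∧
      (∀ z, j z = ∑' n, besselCoeff n * z ^ n) ∧ (∀ z, h z = ∑' n, neumannCoeff n * z ^ n) := by
  have hb := summable_besselCoeff
  have hb1 := summable_norm_succ_mul_pow hb
  have hb2 := summable_norm_succ_mul_pow hb1
  have hn := summable_neumannCoeff
  have hn1 := summable_norm_succ_mul_pow hn
  have hn2 := summable_norm_succ_mul_pow hn1
  -- The Euler operator `z d/dz` multiplies the n-th coefficient by n, so both differential
  -- equations reduce to the coefficient recursions.
  have shift : ∀ {a : ℕ → ℂ}, (∀ r : ℝ, 0 ≤ r → Summable fun n => ‖a n‖ * r ^ n) → ∀ z : ℂ,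
      z * (∑' n : ℕ, (((n + 1 : ℕ) : ℂ) * a (n + 1)) * z ^ n) = ∑' n : ℕ, ((n : ℂ) * a n) * z ^ n := by
    intro a ha z
    have hs : Summable fun n : ℕ => ((n : ℂ) * a n) * z ^ n := by
      rw [← summable_nat_add_iff 1]
      refine ((summable_mul_pow (summable_norm_succ_mul_pow ha) z).mul_left z).congr fun n => ?_
      rw [pow_succ]; ring
    rw [hs.tsum_eq_zero_add, ← tsum_mul_left]
    simp only [Nat.cast_zero, zero_mul, zero_add]
    exact tsum_congr fun n => by rw [pow_succ]; ring
  have shift' : ∀ {a : ℕ → ℂ}, (∀ r : ℝ, 0 ≤ r → Summable fun n => ‖a n‖ * r ^ n) → ∀ z : ℂ,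
      Summable fun n : ℕ => ((n : ℂ) * a n) * z ^ n := by
    intro a ha z
    rw [← summable_nat_add_iff 1]
    refine ((summable_mul_pow (summable_norm_succ_mul_pow ha) z).mul_left z).congr fun n => ?_
    rw [pow_succ]; ring
  refine ⟨_, _, _, _, _, _, hasDerivAt_tsum_mul_pow hb, hasDerivAt_tsum_mul_pow hb1,
    hasDerivAt_tsum_mul_pow hn, hasDerivAt_tsum_mul_pow hn1, fun z => ?_, fun z => ?_,
    ?_, ?_, ?_, fun z => rfl, fun z => rfl⟩
  · rw [shift hb1 z, ← (shift' hb1 z).tsum_add (summable_mul_pow hb1 z),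
      ← ((shift' hb1 z).add (summable_mul_pow hb1 z)).tsum_add (summable_mul_pow hb z)]
    refine (tsum_congr fun n => ?_).trans tsum_zero
    have := besselCoeff_succ n
    push_cast at this ⊢
    linear_combination z ^ n * this
  · rw [shift hn1 z, ← (shift' hn1 z).tsum_add (summable_mul_pow hn1 z),
      ← ((shift' hn1 z).add (summable_mul_pow hn1 z)).tsum_add (summable_mul_pow hn z)]
    refine tsum_congr fun n => ?_
    have := neumannCoeff_succ n
    push_cast at this ⊢
    linear_combination z ^ n * this
  · exact continuous_iff_continuousAt.2 fun z => (hasDerivAt_tsum_mul_pow hb2 z).continuousAt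
  · exact continuous_iff_continuousAt.2 fun z => (hasDerivAt_tsum_mul_pow hn2 z).continuousAt
  · rw [tsum_eq_single 0 (by intro n hn; simp [hn])]
    simp [besselCoeff]

end ConvectedHelmholtz

/-! ### Radial profiles of the Helmholtz equation in dimensions two and three -/

namespace ConvectedHelmholtz

open Filter Topology Complex
open scoped ContDiff

/-- `F`, with derivatives `F1` and `F2`, is a holomorphic function on the slit plane for which
`x ↦ F (|x|²)` is a radial solution of the Helmholtz equation `Δu + κ² u = 0` on `ℝᵈ` outside the
origin, with the singularity of a fundamental solution at the origin. -/
structure IsRadialProfile (d : ℕ) (κ : ℝ) (F F1 F2 : ℂ → ℂ) : Prop where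
  hasDerivAt : ∀ s ∈ slitPlane, HasDerivAt F (F1 s) s
  hasDerivAt_deriv : ∀ s ∈ slitPlane, HasDerivAt F1 (F2 s) s
  -- For u(x) = F(|x|²) and s = |x|², the Laplacian is 4 s F'' + 2 d F'.
  ode : ∀ s : ℝ, 0 < s → 4 * (s : ℂ) * F2 s + 2 * (d : ℂ) * F1 s + (κ : ℂ) ^ 2 * F s = 0
  -- This amounts to F(|x|²) = O(|x|^(-(d-1)/2)), which is locally square integrable; it is sharp
  -- for d = 3 and generous for the logarithm of d = 2.
  tendsto_zero : ∃ c : ℂ, Tendsto (fun s : ℝ => ((s ^ (((d : ℝ) - 1) / 4) : ℝ) : ℂ) * F s)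
    (𝓝[>] 0) (𝓝 c)
  -- The exact order of F'' at zero; c ≠ 0 is what makes the fundamental solution nontrivial.
  tendsto_deriv2 : ∃ c : ℂ, c ≠ 0 ∧
    Tendsto (fun s : ℝ => ((s ^ (((d : ℝ) + 2) / 2) : ℝ) : ℂ) * F2 s) (𝓝[>] 0) (𝓝 c)

theorem tendsto_const_mul_nhdsGT_zero {q : ℝ} (hq : 0 < q) :
    Tendsto (fun s : ℝ => q * s) (𝓝[>] 0) (𝓝[>] 0) := by
  refine tendsto_nhdsWithin_iff.2 ⟨?_, ?_⟩
  · have : Tendsto (fun s : ℝ => q * s) (𝓝 0) (𝓝 (q * 0)) := by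
      exact (continuous_const.mul continuous_id).tendsto 0
    rw [mul_zero] at this
    exact this.mono_left nhdsWithin_le_nhds
  · filter_upwards [self_mem_nhdsWithin] with s hs
    exact mul_pos hq hs

theorem tendsto_ofReal_rpow_mul_clog {r : ℝ} (hr : 0 < r) :
    Tendsto (fun s : ℝ => ((s ^ r : ℝ) : ℂ) * Complex.log s) (𝓝[>] 0) (𝓝 0) := by
  have h := (continuous_ofReal.tendsto 0).comp (tendsto_log_mul_rpow_nhdsGT_zero hr)
  rw [ofReal_zero] at h
  refine h.congr' ?_
  filter_upwards [self_mem_nhdsWithin] with s hs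
  have : (0 : ℝ) < s := hs
  simp only [Function.comp_apply]
  rw [ofReal_mul, ofReal_log this.le, mul_comm]

theorem tendsto_ofReal_rpow_nhdsGT_zero {r : ℝ} (hr : 0 < r) :
    Tendsto (fun s : ℝ => ((s ^ r : ℝ) : ℂ)) (𝓝[>] 0) (𝓝 0) := by
  have h : Tendsto (fun s : ℝ => s ^ r) (𝓝 0) (𝓝 (0 ^ r)) :=
    (Real.continuousAt_rpow_const 0 r (Or.inr hr.le)).tendsto
  rw [Real.zero_rpow hr.ne'] at h
  have := (continuous_ofReal.tendsto 0).comp (h.mono_left (nhdsWithin_le_nhds (s := Set.Ioi 0)))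
  simpa [Function.comp_def] using this

theorem tendsto_comp_ofReal {f : ℂ → ℂ} (hf : Continuous f) :
    Tendsto (fun s : ℝ => f s) (𝓝[>] 0) (𝓝 (f 0)) := by
  have := ((hf.comp continuous_ofReal).tendsto 0).mono_left (nhdsWithin_le_nhds (s := Set.Ioi 0))
  simpa [Function.comp_def] using this

/-- The radial profile of the Hankel function `H₀⁽¹⁾`. -/
theorem exists_radialProfile_two {κ : ℝ} (hκ : 0 < κ) :
    ∃ F F1 F2 : ℂ → ℂ, IsRadialProfile 2 κ F F1 F2 ∧
      ∀ t : ℝ, 0 < t → hankel0 (κ * t) = F ((t ^ 2 : ℝ) : ℂ) := by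
  obtain ⟨j, j1, j2, h, h1, h2, hj, hj1, hh, hh1, odej, odeh, cj2, ch2, j0, jeq, heq⟩ :=
    exists_bessel_entire
  set c : ℂ := 2 * I / Real.pi with hc
  have hc0 : c ≠ 0 := by
    rw [hc]
    exact div_ne_zero (mul_ne_zero two_ne_zero I_ne_zero) (by exact_mod_cast Real.pi_ne_zero)
  set γ : ℂ := (Real.eulerMascheroniConstant : ℂ) with hγ
  -- With s = t², the argument (κt)²/4 of the entire functions is q s.
  set q : ℝ := κ ^ 2 / 4 with hq
  have hq0 : 0 < q := by positivity
  have hqs : ∀ s ∈ slitPlane, (q : ℂ) * s ∈ slitPlane := by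
    intro s hs
    rw [mem_slitPlane_iff] at hs ⊢
    rw [re_ofReal_mul, im_ofReal_mul]
    exact hs.imp (fun h => mul_pos hq0 h) (fun h => mul_ne_zero hq0.ne' h)
  let f : ℂ → ℂ := fun z => j z + c * ((Complex.log z / 2 + γ) * j z - h z)
  let f1 : ℂ → ℂ := fun z => j1 z + c * (z⁻¹ / 2 * j z + (Complex.log z / 2 + γ) * j1 z - h1 z)
  let f2 : ℂ → ℂ := fun z => j2 z + c * ((-(z ^ 2)⁻¹ / 2 * j z + z⁻¹ / 2 * j1 z)
    + (z⁻¹ / 2 * j1 z + (Complex.log z / 2 + γ) * j2 z) - h2 z)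
  have hlog : ∀ z ∈ slitPlane, HasDerivAt (fun z => Complex.log z / 2 + γ) (z⁻¹ / 2) z :=
    fun z hz => ((Complex.hasDerivAt_log hz).div_const 2).add_const γ
  have hf : ∀ z ∈ slitPlane, HasDerivAt f (f1 z) z := fun z hz =>
    (hj z).add ((((hlog z hz).mul (hj z)).sub (hh z)).const_mul c)
  have hf1 : ∀ z ∈ slitPlane, HasDerivAt f1 (f2 z) z := fun z hz =>
    (hj1 z).add ((((((hasDerivAt_inv (slitPlane_ne_zero hz)).div_const 2).mul (hj z)).add
      ((hlog z hz).mul (hj1 z))).sub (hh1 z)).const_mul c)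
  have hq' : ∀ s : ℂ, HasDerivAt (fun s : ℂ => (q : ℂ) * s) q s := fun s => by
    simpa using (hasDerivAt_id s).const_mul (q : ℂ)
  have cj : Continuous j := continuous_iff_continuousAt.2 fun z => (hj z).continuousAt
  have cj1 : Continuous j1 := continuous_iff_continuousAt.2 fun z => (hj1 z).continuousAt
  have ch : Continuous h := continuous_iff_continuousAt.2 fun z => (hh z).continuousAt
  refine ⟨fun s => f (q * s), fun s => f1 (q * s) * q, fun s => f2 (q * s) * q * q,
    ⟨?_, ?_, ?_, ?_, ?_⟩, ?_⟩
  · intro s hs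
    exact (hf _ (hqs s hs)).comp s (hq' s)
  · intro s hs
    exact ((hf1 _ (hqs s hs)).comp s (hq' s)).mul_const _
  · intro s hs
    have hs' : ((q : ℂ) * s) ≠ 0 := by
      rw [← ofReal_mul]; exact_mod_cast (mul_pos hq0 hs).ne'
    have hκq : (κ : ℂ) ^ 2 = 4 * q := by rw [hq]; push_cast; ring
    have e1 := odej (q * s)
    have e2 := odeh (q * s)
    -- Differentiating the logarithm leaves exactly `j1`: the two terms in `z⁻¹ j` cancel. This `j1`
    -- cancels the right-hand side of the equation for `h`.
    have e3 : (q : ℂ) * s * f2 (q * s) + f1 (q * s) + f (q * s) = 0 := by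
      simp only [f, f1, f2]
      set z := (q : ℂ) * s
      have i1 : z * z⁻¹ = 1 := mul_inv_cancel₀ hs'
      have i2 : z * (z ^ 2)⁻¹ = z⁻¹ := by field_simp
      linear_combination (1 + c * (Complex.log z / 2 + γ)) * e1 - c * e2
        + c * j1 z * i1 - c / 2 * j z * i2
    rw [hκq]
    push_cast
    linear_combination 4 * (q : ℂ) * e3
  · refine ⟨0, ?_⟩
    have key : Tendsto (fun s : ℝ => ((s ^ ((1 : ℝ) / 4) : ℝ) : ℂ) * f s) (𝓝[>] 0) (𝓝 0) := by
      have t1 := tendsto_ofReal_rpow_nhdsGT_zero (r := 1 / 4) (by norm_num)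
      have t2 := tendsto_ofReal_rpow_mul_clog (r := 1 / 4) (by norm_num)
      have t3 := (t1.mul (tendsto_comp_ofReal cj)).add ((((t2.mul_const (1 / 2)).add
        (t1.mul_const γ)).mul (tendsto_comp_ofReal cj)).sub
          (t1.mul (tendsto_comp_ofReal ch)) |>.const_mul c)
      simp only [zero_mul, add_zero, sub_zero, mul_zero] at t3
      refine t3.congr fun s => ?_
      simp only [f]
      ring
    have key2 := ((key.comp (tendsto_const_mul_nhdsGT_zero hq0)).const_mul
      (((q ^ ((1 : ℝ) / 4))⁻¹ : ℝ) : ℂ))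
    rw [mul_zero] at key2
    refine key2.congr' ?_
    filter_upwards [self_mem_nhdsWithin] with s hs
    have hs' : (0 : ℝ) < s := hs
    have hqr : ((q ^ ((1 : ℝ) / 4) : ℝ) : ℂ) ≠ 0 := by
      exact_mod_cast (Real.rpow_pos_of_pos hq0 _).ne'
    simp only [Function.comp_apply]
    rw [Real.mul_rpow hq0.le hs'.le, ← mul_assoc, ofReal_inv, ofReal_mul, ← mul_assoc,
      inv_mul_cancel₀ hqr, one_mul, ofReal_mul]
    norm_num
  -- The leading term is the second derivative -1/(2z²) of (log z)/2, times `c` and `j 0 = 1`; the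
  -- powers of q cancel against the scaling.
  · refine ⟨-c / 2, by simpa using hc0, ?_⟩
    have key : Tendsto (fun s : ℝ => (s : ℂ) ^ 2 * f2 s) (𝓝[>] 0) (𝓝 (-c / 2)) := by
      have t0 : Tendsto (fun s : ℝ => (s : ℂ)) (𝓝[>] 0) (𝓝 0) := tendsto_comp_ofReal continuous_id
      have t2 := tendsto_ofReal_rpow_mul_clog (r := 1) (by norm_num)
      simp only [Real.rpow_one] at t2
      have u1 := (t0.pow 2).mul (tendsto_comp_ofReal cj2)
      have u2 := (tendsto_comp_ofReal cj).const_mul (-c / 2)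
      have u3 := (t0.mul (tendsto_comp_ofReal cj1)).const_mul c
      have u4 := (((t0.mul t2).mul_const (1 / 2)).mul (tendsto_comp_ofReal cj2)).const_mul c
      have u5 := (((t0.pow 2).mul_const γ).mul (tendsto_comp_ofReal cj2)).const_mul c
      have u6 := ((t0.pow 2).mul (tendsto_comp_ofReal ch2)).const_mul c
      have t3 := ((((u1.add u2).add u3).add u4).add u5).sub u6
      simp only [j0, ne_eq, OfNat.ofNat_ne_zero, not_false_eq_true, zero_pow, zero_mul, mul_zero,
        zero_add, add_zero, sub_zero, mul_one] at t3
      refine t3.congr' ?_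
      filter_upwards [self_mem_nhdsWithin] with s hs
      have hs' : (s : ℂ) ≠ 0 := by exact_mod_cast (ne_of_gt hs : s ≠ 0)
      simp only [f2]
      field_simp
      ring
    refine (key.comp (tendsto_const_mul_nhdsGT_zero hq0)).congr fun s => ?_
    have : (((2 : ℕ) : ℝ) + 2) / 2 = ((2 : ℕ) : ℝ) := by norm_num
    simp only [Function.comp_apply]
    rw [this, Real.rpow_natCast]
    push_cast
    ring
  · intro t ht
    have hz : ((q * t ^ 2 : ℝ)) = (κ * t / 2) ^ 2 := by rw [hq]; ring
    have hz' : (q : ℂ) * ((t ^ 2 : ℝ) : ℂ) = (((κ * t / 2) ^ 2 : ℝ) : ℂ) := by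
      rw [← hz]; push_cast; ring
    have hJ : (besselJ0 (κ * t) : ℂ) = j (q * ((t ^ 2 : ℝ) : ℂ)) := by
      rw [jeq, hz', besselJ0, ofReal_tsum]
      refine tsum_congr fun n => ?_
      rw [besselCoeff, pow_mul]; push_cast; ring
    have hH : ((∑' n : ℕ, (-1 : ℝ) ^ n * ((harmonic n : ℚ) : ℝ) / (n.factorial : ℝ) ^ 2
        * (κ * t / 2) ^ (2 * n) : ℝ) : ℂ) = h (q * ((t ^ 2 : ℝ) : ℂ)) := by
      rw [heq, hz', ofReal_tsum]
      refine tsum_congr fun n => ?_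
      rw [neumannCoeff, pow_mul]; push_cast; ring
    have hL : Complex.log (q * ((t ^ 2 : ℝ) : ℂ)) / 2 = (Real.log (κ * t / 2) : ℂ) := by
      rw [hz', ← ofReal_log (by positivity), Real.log_pow]; push_cast; ring
    simp only [f]
    rw [hL, ← hJ, ← hH, hankel0, besselY0, hc, hγ]
    push_cast
    ring

/-- The radial profile of the three-dimensional outgoing fundamental solution. -/
theorem exists_radialProfile_three (κ : ℝ) :
    ∃ F F1 F2 : ℂ → ℂ, IsRadialProfile 3 κ F F1 F2 ∧
      ∀ t : ℝ, 0 < t → Complex.exp (I * ((κ * t : ℝ) : ℂ)) / (t : ℂ) = F ((t ^ 2 : ℝ) : ℂ) := by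
  -- The holomorphic square root on the slit plane; the profile is exp(iκ√s)/√s.
  let r : ℂ → ℂ := fun s => Complex.exp (Complex.log s / 2)
  have hr0 : ∀ s, r s ≠ 0 := fun s => Complex.exp_ne_zero _
  have hr : ∀ s ∈ slitPlane, HasDerivAt r ((r s)⁻¹ / 2) s := by
    intro s hs
    have h := ((Complex.hasDerivAt_log hs).div_const 2).cexp
    convert! h using 1
    have h2 : r s * r s = s := by
      simp only [r]
      rw [← Complex.exp_add, add_halves, Complex.exp_log (slitPlane_ne_zero hs)]
    change (r s)⁻¹ / 2 = r s * (s⁻¹ / 2)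
    have h3 : s⁻¹ = (r s)⁻¹ * (r s)⁻¹ := by rw [← mul_inv, h2]
    have := hr0 s
    rw [h3]
    field_simp
  have hrt : ∀ t : ℝ, 0 < t → r ((t ^ 2 : ℝ) : ℂ) = t := by
    intro t ht
    simp only [r]
    rw [← ofReal_log (by positivity), Real.log_pow]
    have : (((2 : ℕ) * Real.log t : ℝ) : ℂ) / 2 = (Real.log t : ℂ) := by push_cast; ring
    rw [this, ← ofReal_exp, Real.exp_log ht]
  let e : ℂ → ℂ := fun w => Complex.exp (I * κ * w)
  have he : ∀ w, HasDerivAt e (I * κ * e w) w := by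
    intro w
    have h := ((hasDerivAt_id w).const_mul (I * κ)).cexp
    simp only [id, mul_one] at h
    rw [mul_comm]
    exact h
  have ce : Continuous e := continuous_iff_continuousAt.2 fun w => (he w).continuousAt
  let φ : ℂ → ℂ := fun w => e w * w⁻¹
  -- `φ1` and `φ2` are the derivatives with respect to s = w², hence the factor 2w when
  -- differentiating in w.
  let φ1 : ℂ → ℂ := fun w => e w * (I * κ / 2 * (w⁻¹) ^ 2 - 1 / 2 * (w⁻¹) ^ 3)
  let φ2 : ℂ → ℂ := fun w => e w * (-3 / 4 * I * κ * (w⁻¹) ^ 4 + 3 / 4 * (w⁻¹) ^ 5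
    - κ ^ 2 / 4 * (w⁻¹) ^ 3)
  have hφ : ∀ w, w ≠ 0 → HasDerivAt φ (φ1 w * (2 * w)) w := by
    intro w hw
    have h := (he w).mul (hasDerivAt_inv hw)
    convert! h using 1
    simp only [φ1]
    field_simp
    ring
  have hφ1 : ∀ w, w ≠ 0 → HasDerivAt φ1 (φ2 w * (2 * w)) w := by
    intro w hw
    have h := (he w).mul ((((hasDerivAt_inv hw).pow 2).const_mul (I * κ / 2)).sub
      (((hasDerivAt_inv hw).pow 3).const_mul (1 / 2)))
    convert! h using 1
    simp only [φ2, Pi.pow_apply, Pi.sub_apply]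
    push_cast
    field_simp
    ring_nf
    simp only [I_sq]
    ring
  refine ⟨fun s => φ (r s), fun s => φ1 (r s), fun s => φ2 (r s), ⟨?_, ?_, ?_, ?_, ?_⟩, ?_⟩
  · intro s hs
    have h := (hφ _ (hr0 s)).comp s (hr s hs)
    convert! h using 1
    have := hr0 s
    field_simp
  · intro s hs
    have h := (hφ1 _ (hr0 s)).comp s (hr s hs)
    convert! h using 1
    have := hr0 s
    field_simp
  · intro s hs
    have ht := Real.sqrt_pos.2 hs
    have hs2 : s = (Real.sqrt s) ^ 2 := (Real.sq_sqrt hs.le).symm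
    rw [hs2]
    rw [hrt _ ht]
    have : ((Real.sqrt s : ℝ) : ℂ) ≠ 0 := by exact_mod_cast ht.ne'
    simp only [φ, φ1, φ2]
    push_cast
    field_simp
    ring_nf
  · refine ⟨1, ?_⟩
    have t1 : Tendsto (fun s : ℝ => e ((Real.sqrt s : ℝ) : ℂ)) (𝓝[>] 0) (𝓝 (e ((Real.sqrt 0 : ℝ) : ℂ))) :=
      ((ce.comp (continuous_ofReal.comp Real.continuous_sqrt)).tendsto 0).mono_left
        nhdsWithin_le_nhds
    have e0 : e ((Real.sqrt 0 : ℝ) : ℂ) = 1 := by simp [e]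
    rw [e0] at t1
    refine t1.congr' ?_
    filter_upwards [self_mem_nhdsWithin] with s hs
    have hs' : (0 : ℝ) < s := hs
    have ht := Real.sqrt_pos.2 hs'
    have h1 : r s = ((Real.sqrt s : ℝ) : ℂ) := by
      rw [← hrt _ ht, Real.sq_sqrt hs'.le]
    have h2 : s ^ ((((3 : ℕ) : ℝ) - 1) / 4) = Real.sqrt s := by
      rw [Real.sqrt_eq_rpow]; norm_num
    have : ((Real.sqrt s : ℝ) : ℂ) ≠ 0 := by exact_mod_cast ht.ne'
    simp only [φ]
    rw [h1, h2]
    field_simp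
  -- The most singular term of `φ2` is (3/4) w⁻⁵, and s^(5/2) = w⁵.
  · refine ⟨3 / 4, by norm_num, ?_⟩
    let g : ℂ → ℂ := fun w => e w * (-3 / 4 * I * κ * w + 3 / 4 - κ ^ 2 / 4 * w ^ 2)
    have cg : Continuous g := by fun_prop
    have t1 : Tendsto (fun s : ℝ => g ((Real.sqrt s : ℝ) : ℂ)) (𝓝[>] 0) (𝓝 (g ((Real.sqrt 0 : ℝ) : ℂ))) :=
      ((cg.comp (continuous_ofReal.comp Real.continuous_sqrt)).tendsto 0).mono_left
        nhdsWithin_le_nhds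
    have e0 : g ((Real.sqrt 0 : ℝ) : ℂ) = 3 / 4 := by simp [g, e]
    rw [e0] at t1
    refine t1.congr' ?_
    filter_upwards [self_mem_nhdsWithin] with s hs
    have hs' : (0 : ℝ) < s := hs
    have ht := Real.sqrt_pos.2 hs'
    have h1 : r s = ((Real.sqrt s : ℝ) : ℂ) := by
      rw [← hrt _ ht, Real.sq_sqrt hs'.le]
    have h2 : s ^ ((((3 : ℕ) : ℝ) + 2) / 2) = Real.sqrt s ^ 5 := by
      rw [Real.sqrt_eq_rpow, ← Real.rpow_natCast, ← Real.rpow_mul hs'.le]; norm_num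
    have : ((Real.sqrt s : ℝ) : ℂ) ≠ 0 := by exact_mod_cast ht.ne'
    simp only [φ2, g]
    rw [h1, h2]
    push_cast
    field_simp
  · intro t ht
    simp only [φ, e]
    rw [hrt t ht, div_eq_mul_inv]
    push_cast
    rw [mul_assoc]

end ConvectedHelmholtz

/-! ### The Mach form, the conjugated operator and Green's identity -/

namespace ConvectedHelmholtz

open Filter Topology Complex
open scoped ContDiff

variable {d : ℕ}

/-- The bilinear form whose quadratic form is the square of the Mach norm. -/
noncomputable def machBilin (m x y : EuclideanSpace ℝ (Fin d)) : ℝ :=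
  inner ℝ x m * inner ℝ y m + betaSq m * inner ℝ x y

theorem betaSq_pos {m : EuclideanSpace ℝ (Fin d)} (hm : ‖m‖ < 1) : 0 < betaSq m := by
  have := norm_nonneg m
  rw [betaSq]; nlinarith

theorem betaSq_le_one (m : EuclideanSpace ℝ (Fin d)) : betaSq m ≤ 1 := by
  rw [betaSq]; nlinarith [sq_nonneg ‖m‖]

theorem machBilin_add_smul (m x b : EuclideanSpace ℝ (Fin d)) (t : ℝ) :
    machBilin m (x + t • b) (x + t • b)
      = machBilin m x x + 2 * t * machBilin m x b + t ^ 2 * machBilin m b b := by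
  simp only [machBilin, inner_add_left, inner_add_right, real_inner_smul_left,
    real_inner_smul_right, real_inner_comm x b]
  ring

theorem machBilin_add_smul_left (m x b c : EuclideanSpace ℝ (Fin d)) (t : ℝ) :
    machBilin m (x + t • b) c = machBilin m x c + t * machBilin m b c := by
  simp only [machBilin, inner_add_left, real_inner_smul_left]
  ring

theorem machBilin_smul_smul (m x : EuclideanSpace ℝ (Fin d)) (t : ℝ) :
    machBilin m (t • x) (t • x) = t ^ 2 * machBilin m x x := by
  simp only [machBilin, real_inner_smul_right, real_inner_smul_left]
  ring

theorem inner_machA (m x y : EuclideanSpace ℝ (Fin d)) :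
    inner ℝ (machA m x) y = machBilin m x y := by
  rw [machA, machBilin, inner_add_left, real_inner_smul_left, real_inner_smul_left,
    real_inner_comm m x, real_inner_comm m y]

theorem le_machBilin_self (m x : EuclideanSpace ℝ (Fin d)) :
    betaSq m * ‖x‖ ^ 2 ≤ machBilin m x x := by
  rw [machBilin, real_inner_self_eq_norm_sq]
  nlinarith [sq_nonneg (inner ℝ x m)]

theorem machBilin_self_pos {m : EuclideanSpace ℝ (Fin d)} (hm : ‖m‖ < 1)
    {x : EuclideanSpace ℝ (Fin d)} (hx : x ≠ 0) : 0 < machBilin m x x :=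
  lt_of_lt_of_le (mul_pos (betaSq_pos hm) (pow_pos (norm_pos_iff.2 hx) 2)) (le_machBilin_self m x)

theorem machBilin_self_nonneg {m : EuclideanSpace ℝ (Fin d)} (hm : ‖m‖ < 1)
    (x : EuclideanSpace ℝ (Fin d)) : 0 ≤ machBilin m x x :=
  (mul_nonneg (betaSq_pos hm).le (sq_nonneg _)).trans (le_machBilin_self m x)

/-- Cauchy–Schwarz on both summands; the constant is one because |m|² + β² = 1. -/
theorem abs_machBilin_le {m : EuclideanSpace ℝ (Fin d)} (hm : ‖m‖ < 1)
    (x y : EuclideanSpace ℝ (Fin d)) : |machBilin m x y| ≤ ‖x‖ * ‖y‖ := by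
  have hb := betaSq_pos hm
  have h1 : |inner ℝ x m * inner ℝ y m| ≤ (‖x‖ * ‖m‖) * (‖y‖ * ‖m‖) := by
    rw [abs_mul]
    exact mul_le_mul (abs_real_inner_le_norm _ _) (abs_real_inner_le_norm _ _) (abs_nonneg _)
      (by positivity)
  have h2 : |betaSq m * inner ℝ x y| ≤ betaSq m * (‖x‖ * ‖y‖) := by
    rw [abs_mul, abs_of_pos hb]
    exact mul_le_mul_of_nonneg_left (abs_real_inner_le_norm _ _) hb.le
  refine (abs_add_le _ _).trans ((add_le_add h1 h2).trans (le_of_eq ?_))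
  rw [betaSq]; ring

theorem machNorm_eq_sqrt (m x : EuclideanSpace ℝ (Fin d)) :
    machNorm m x = Real.sqrt (machBilin m x x) := by
  rw [machNorm, machBilin, real_inner_self_eq_norm_sq, sq]

theorem machNorm_sq {m : EuclideanSpace ℝ (Fin d)} (hm : ‖m‖ < 1) (x : EuclideanSpace ℝ (Fin d)) :
    machNorm m x ^ 2 = machBilin m x x := by
  rw [machNorm_eq_sqrt, Real.sq_sqrt (machBilin_self_nonneg hm x)]

theorem machNorm_pos {m : EuclideanSpace ℝ (Fin d)} (hm : ‖m‖ < 1)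
    {x : EuclideanSpace ℝ (Fin d)} (hx : x ≠ 0) : 0 < machNorm m x := by
  rw [machNorm_eq_sqrt]
  exact Real.sqrt_pos.2 (machBilin_self_pos hm hx)

@[fun_prop]
theorem continuous_machBilin_self (m : EuclideanSpace ℝ (Fin d)) :
    Continuous fun x => machBilin m x x := by
  unfold machBilin
  fun_prop

theorem continuous_machBilin_left (m b : EuclideanSpace ℝ (Fin d)) :
    Continuous fun x => machBilin m x b := by
  unfold machBilin
  fun_prop

/-- The identity A (I - m mᵀ) A = β² A. It makes |x|_m² play, for the operator Δ - (m·∇)², the role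
that |x|² plays for the Laplacian, up to the factor β². -/
theorem sum_machBilin_single_sq (m x : EuclideanSpace ℝ (Fin d)) :
    ∑ i, machBilin m x (EuclideanSpace.single i 1) ^ 2 - machBilin m x m ^ 2
      = betaSq m * machBilin m x x := by
  have h1 : ∀ i, machBilin m x (EuclideanSpace.single i 1) = machA m x i := by
    intro i
    rw [← inner_machA, EuclideanSpace.inner_single_right]
    simp
  have h2 : ∑ i, (machA m x i) ^ 2 = inner ℝ (machA m x) (machA m x) := by
    rw [real_inner_self_eq_norm_sq, EuclideanSpace.real_norm_sq_eq]
  simp only [h1]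
  rw [h2, inner_machA]
  simp only [machA, machBilin, inner_add_left, inner_add_right, real_inner_smul_left,
    real_inner_smul_right, real_inner_self_eq_norm_sq, real_inner_comm x m]
  simp only [betaSq]
  ring

/-- The trace of (I - m mᵀ) A = β² I; it supplies the first-order term 2 d F' of the radial
equation. -/
theorem sum_machBilin_single_single (m : EuclideanSpace ℝ (Fin d)) :
    ∑ i : Fin d, machBilin m (EuclideanSpace.single i 1) (EuclideanSpace.single i 1)
      - machBilin m m m = d * betaSq m := by
  have h1 : ∀ i : Fin d, machBilin m (EuclideanSpace.single i 1) (EuclideanSpace.single i 1)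
      = m i ^ 2 + betaSq m := by
    intro i
    rw [machBilin, EuclideanSpace.inner_single_left, real_inner_self_eq_norm_sq]
    simp
    ring
  simp only [h1, Finset.sum_add_distrib, ← EuclideanSpace.real_norm_sq_eq]
  simp only [machBilin, real_inner_self_eq_norm_sq, Finset.sum_const, Finset.card_univ,
    Fintype.card_fin, nsmul_eq_mul]
  simp only [betaSq]
  ring

/-- The second derivative in the direction `b`. -/
noncomputable def lineDeriv₂ (b : EuclideanSpace ℝ (Fin d)) (φ : EuclideanSpace ℝ (Fin d) → ℂ)
    (x : EuclideanSpace ℝ (Fin d)) : ℂ :=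
  fderiv ℝ (fun y => fderiv ℝ φ y b) x b

/-- The operator `Δ - (m·∇)² + κ² β²`, which is the convected Helmholtz operator conjugated by
`exp(i κ m·x)`. -/
noncomputable def convOp (κ : ℝ) (m : EuclideanSpace ℝ (Fin d)) (φ : EuclideanSpace ℝ (Fin d) → ℂ)
    (x : EuclideanSpace ℝ (Fin d)) : ℂ :=
  ∑ i, lineDeriv₂ (EuclideanSpace.single i 1) φ x - lineDeriv₂ m φ x + κ ^ 2 * betaSq m * φ x

section Smooth

variable {φ : EuclideanSpace ℝ (Fin d) → ℂ}

theorem contDiff_fderiv_apply (hφ : ContDiff ℝ ∞ φ) (b : EuclideanSpace ℝ (Fin d)) :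
    ContDiff ℝ ∞ fun y => fderiv ℝ φ y b :=
  (hφ.fderiv_right (m := ∞) (by simp)).clm_apply contDiff_const

theorem continuous_lineDeriv₂ (hφ : ContDiff ℝ ∞ φ) (b : EuclideanSpace ℝ (Fin d)) :
    Continuous (lineDeriv₂ b φ) :=
  (contDiff_fderiv_apply (contDiff_fderiv_apply hφ b) b).continuous

theorem continuous_convOp (hφ : ContDiff ℝ ∞ φ) (κ : ℝ) (m : EuclideanSpace ℝ (Fin d)) :
    Continuous (convOp κ m φ) :=
  ((continuous_finsetSum _ fun _ _ => continuous_lineDeriv₂ hφ _).sub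
    (continuous_lineDeriv₂ hφ _)).add (continuous_const.mul hφ.continuous)

theorem hasCompactSupport_lineDeriv₂ (hc : HasCompactSupport φ) (b : EuclideanSpace ℝ (Fin d)) :
    HasCompactSupport (lineDeriv₂ b φ) :=
  (hc.fderiv_apply ℝ b).fderiv_apply ℝ b

theorem lineDeriv₂_congr {χ : EuclideanSpace ℝ (Fin d) → ℂ} {x : EuclideanSpace ℝ (Fin d)}
    (h : φ =ᶠ[𝓝 x] χ) (b : EuclideanSpace ℝ (Fin d)) : lineDeriv₂ b φ x = lineDeriv₂ b χ x := by
  have h1 : (fun y => fderiv ℝ φ y b) =ᶠ[𝓝 x] fun y => fderiv ℝ χ y b := by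
    filter_upwards [h.fderiv (𝕜 := ℝ)] with y hy
    rw [hy]
  rw [lineDeriv₂, lineDeriv₂, h1.fderiv_eq]

theorem convOp_congr {χ : EuclideanSpace ℝ (Fin d) → ℂ} {x : EuclideanSpace ℝ (Fin d)}
    (h : φ =ᶠ[𝓝 x] χ) (κ : ℝ) (m : EuclideanSpace ℝ (Fin d)) :
    convOp κ m φ x = convOp κ m χ x := by
  simp only [convOp, lineDeriv₂_congr h, h.eq_of_nhds]

theorem hasCompactSupport_convOp (hc : HasCompactSupport φ) (κ : ℝ)
    (m : EuclideanSpace ℝ (Fin d)) : HasCompactSupport (convOp κ m φ) := by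
  refine HasCompactSupport.intro hc fun x hx => ?_
  have h : φ =ᶠ[𝓝 x] fun _ => 0 := notMem_tsupport_iff_eventuallyEq.1 hx
  rw [convOp_congr h]
  simp [convOp, lineDeriv₂]

/-- Integration by parts, twice in the direction `b`, against a test function. -/
theorem integral_mul_lineDeriv₂ (hφ : ContDiff ℝ ∞ φ) (hc : HasCompactSupport φ)
    {f f1 f2 : EuclideanSpace ℝ (Fin d) → ℂ} {b : EuclideanSpace ℝ (Fin d)}
    (hf : Continuous f) (hf1 : Continuous f1) (hf2 : Continuous f2)
    (hd : ∀ x, HasLineDerivAt ℝ f (f1 x) x b) (hd1 : ∀ x, HasLineDerivAt ℝ f1 (f2 x) x b) :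
    ∫ x, f x * lineDeriv₂ b φ x = ∫ x, f2 x * φ x := by
  have hφ1 := contDiff_fderiv_apply hφ b
  have hc1 : HasCompactSupport fun y => fderiv ℝ φ y b := hc.fderiv_apply ℝ b
  have hc2 : HasCompactSupport (lineDeriv₂ b φ) := hasCompactSupport_lineDeriv₂ hc b
  have i : ∀ {u v : EuclideanSpace ℝ (Fin d) → ℂ}, Continuous u → Continuous v →
      HasCompactSupport v → Integrable fun x => u x * v x := fun hu hv hcv =>
    (hu.mul hv).integrable_of_hasCompactSupport hcv.mul_left
  have s1 := integral_bilinear_hasLineDerivAt_right_eq_neg_left_of_integrable (μ := volume)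
    (B := ContinuousLinearMap.mul ℝ ℂ) (f := f) (f' := f1) (g := fun y => fderiv ℝ φ y b)
    (g' := lineDeriv₂ b φ) (v := b) (i hf1 hφ1.continuous hc1)
    (i hf (continuous_lineDeriv₂ hφ b) hc2) (i hf hφ1.continuous hc1) (fun x _ => hd x)
    (fun x _ => ((hφ1.differentiable (by simp)) x).hasFDerivAt.hasLineDerivAt b)
  have s2 := integral_bilinear_hasLineDerivAt_right_eq_neg_left_of_integrable (μ := volume)
    (B := ContinuousLinearMap.mul ℝ ℂ) (f := f1) (f' := f2) (g := φ)
    (g' := fun y => fderiv ℝ φ y b) (v := b) (i hf2 hφ.continuous hc)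
    (i hf1 hφ1.continuous hc1) (i hf1 hφ.continuous hc) (fun x _ => hd1 x)
    (fun x _ => ((hφ.differentiable (by simp)) x).hasFDerivAt.hasLineDerivAt b)
  simp only [ContinuousLinearMap.mul_apply'] at s1 s2
  rw [s1, s2, neg_neg]

end Smooth

section Profile

variable {κ : ℝ} {m : EuclideanSpace ℝ (Fin d)} {F F1 F2 : ℂ → ℂ}

theorem ofReal_mem_slitPlane' {s : ℝ} (hs : 0 < s) : (s : ℂ) ∈ slitPlane :=
  Complex.ofReal_mem_slitPlane.2 hs

theorem IsRadialProfile.continuousOn (hF : IsRadialProfile d κ F F1 F2) :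
    ContinuousOn F slitPlane := fun s hs => (hF.hasDerivAt s hs).continuousAt.continuousWithinAt

theorem IsRadialProfile.continuousOn_deriv (hF : IsRadialProfile d κ F F1 F2) :
    ContinuousOn F1 slitPlane :=
  fun s hs => (hF.hasDerivAt_deriv s hs).continuousAt.continuousWithinAt

theorem IsRadialProfile.continuousOn_deriv2 (hF : IsRadialProfile d κ F F1 F2) :
    ContinuousOn F2 slitPlane := by
  have h : DifferentiableOn ℂ F1 slitPlane :=
    fun s hs => (hF.hasDerivAt_deriv s hs).differentiableAt.differentiableWithinAt
  exact (h.deriv isOpen_slitPlane).continuousOn.congr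
    fun s hs => ((hF.hasDerivAt_deriv s hs).deriv).symm

/-- The shift by ε keeps the argument positive even at x = y, so Green's identity can be used on the
whole space without excising a ball. -/
theorem continuous_comp_machBilin {G : ℂ → ℂ} (hG : ContinuousOn G slitPlane) (hm : ‖m‖ < 1)
    {ε : ℝ} (hε : 0 < ε) (y : EuclideanSpace ℝ (Fin d)) :
    Continuous fun x => G ((machBilin m (x - y) (x - y) + ε : ℝ) : ℂ) := by
  refine hG.comp_continuous ?_ fun x => ofReal_mem_slitPlane'
    (add_pos_of_nonneg_of_pos (machBilin_self_nonneg hm _) hε)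
  exact continuous_ofReal.comp (((continuous_machBilin_self m).comp
    (continuous_id.sub continuous_const)).add continuous_const)

theorem hasLineDerivAt_comp_machBilin {G G1 : ℂ → ℂ} (hG : ∀ s ∈ slitPlane, HasDerivAt G (G1 s) s)
    (hm : ‖m‖ < 1) {ε : ℝ} (hε : 0 < ε) (y b x : EuclideanSpace ℝ (Fin d)) :
    HasLineDerivAt ℝ (fun x => G ((machBilin m (x - y) (x - y) + ε : ℝ) : ℂ))
      (G1 ((machBilin m (x - y) (x - y) + ε : ℝ) : ℂ) * ((2 * machBilin m (x - y) b : ℝ) : ℂ))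
      x b := by
  have hp : ∀ t : ℝ, machBilin m (x + t • b - y) (x + t • b - y) + ε
      = machBilin m (x - y) (x - y) + 2 * t * machBilin m (x - y) b + t ^ 2 * machBilin m b b + ε := by
    intro t
    rw [← machBilin_add_smul, add_sub_right_comm]
  have hd : HasDerivAt (fun t : ℝ => machBilin m (x + t • b - y) (x + t • b - y) + ε)
      (2 * machBilin m (x - y) b) 0 := by
    simp only [hp]
    have h := ((((hasDerivAt_id (0 : ℝ)).const_mul 2).mul_const (machBilin m (x - y) b)).const_add
      (machBilin m (x - y) (x - y))).add (((hasDerivAt_id (0 : ℝ)).pow 2).mul_const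
        (machBilin m b b)) |>.add_const ε
    convert! h using 1
    simp
  have hs : 0 < machBilin m (x - y) (x - y) + ε :=
    add_pos_of_nonneg_of_pos (machBilin_self_nonneg hm _) hε
  have hG' := hG _ (ofReal_mem_slitPlane' hs)
  have h := HasDerivAt.comp_of_eq (h₂ := G)
    (h := fun t : ℝ => ((machBilin m (x + t • b - y) (x + t • b - y) + ε : ℝ) : ℂ))
    (0 : ℝ) hG' hd.ofReal_comp (by simp)
  exact h

theorem hasLineDerivAt_machBilin (m y b c x : EuclideanSpace ℝ (Fin d)) :
    HasLineDerivAt ℝ (fun x => ((2 * machBilin m (x - y) c : ℝ) : ℂ))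
      ((2 * machBilin m b c : ℝ) : ℂ) x b := by
  have hp : ∀ t : ℝ, 2 * machBilin m (x + t • b - y) c
      = 2 * machBilin m (x - y) c + t * (2 * machBilin m b c) := by
    intro t
    rw [add_sub_right_comm, machBilin_add_smul_left]; ring
  have hd : HasDerivAt (fun t : ℝ => 2 * machBilin m (x + t • b - y) c)
      (2 * machBilin m b c) 0 := by
    simp only [hp]
    simpa using ((hasDerivAt_id (0 : ℝ)).mul_const (2 * machBilin m b c)).const_add
      (2 * machBilin m (x - y) c)
  exact hd.ofReal_comp

/-- Green's identity for the regularised fundamental solution. -/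
theorem IsRadialProfile.integral_mul_convOp (hF : IsRadialProfile d κ F F1 F2) (hm : ‖m‖ < 1)
    {φ : EuclideanSpace ℝ (Fin d) → ℂ} (hφ : ContDiff ℝ ∞ φ) (hc : HasCompactSupport φ)
    {ε : ℝ} (hε : 0 < ε) (y : EuclideanSpace ℝ (Fin d)) :
    ∫ x, F ((machBilin m (x - y) (x - y) + ε : ℝ) : ℂ) * convOp κ m φ x
      = ∫ x, -(4 * betaSq m * ε) * F2 ((machBilin m (x - y) (x - y) + ε : ℝ) : ℂ) * φ x := by
  set f := fun x => F ((machBilin m (x - y) (x - y) + ε : ℝ) : ℂ) with hf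
  let f1 := fun b x => F1 ((machBilin m (x - y) (x - y) + ε : ℝ) : ℂ)
    * ((2 * machBilin m (x - y) b : ℝ) : ℂ)
  let f2 := fun b x => F2 ((machBilin m (x - y) (x - y) + ε : ℝ) : ℂ)
    * ((2 * machBilin m (x - y) b : ℝ) : ℂ) * ((2 * machBilin m (x - y) b : ℝ) : ℂ)
    + F1 ((machBilin m (x - y) (x - y) + ε : ℝ) : ℂ) * ((2 * machBilin m b b : ℝ) : ℂ)
  have cf : Continuous f := continuous_comp_machBilin hF.continuousOn hm hε y
  have cb : ∀ b, Continuous fun x => ((2 * machBilin m (x - y) b : ℝ) : ℂ) := fun b =>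
    continuous_ofReal.comp (continuous_const.mul ((continuous_machBilin_left m b).comp
      (continuous_id.sub continuous_const)))
  have cf1 : ∀ b, Continuous (f1 b) := fun b =>
    (continuous_comp_machBilin hF.continuousOn_deriv hm hε y).mul (cb b)
  have cf2 : ∀ b, Continuous (f2 b) := fun b =>
    (((continuous_comp_machBilin hF.continuousOn_deriv2 hm hε y).mul (cb b)).mul (cb b)).add
      ((continuous_comp_machBilin hF.continuousOn_deriv hm hε y).mul continuous_const)
  have ibp : ∀ b, ∫ x, f x * lineDeriv₂ b φ x = ∫ x, f2 b x * φ x := fun b =>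
    integral_mul_lineDeriv₂ hφ hc cf (cf1 b) (cf2 b)
      (fun x => hasLineDerivAt_comp_machBilin hF.hasDerivAt hm hε y b x)
      (fun x => by
        have h := HasDerivAt.mul (hasLineDerivAt_comp_machBilin hF.hasDerivAt_deriv hm hε y b x)
          (hasLineDerivAt_machBilin m y b b x)
        simp only [zero_smul, add_zero] at h
        exact h)
  have i : ∀ {u v : EuclideanSpace ℝ (Fin d) → ℂ}, Continuous u → Continuous v →
      HasCompactSupport v → Integrable fun x => u x * v x := fun hu hv hcv =>
    (hu.mul hv).integrable_of_hasCompactSupport hcv.mul_left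
  have id2 : ∀ b, Integrable fun x => f x * lineDeriv₂ b φ x := fun b =>
    i cf (continuous_lineDeriv₂ hφ b) (hasCompactSupport_lineDeriv₂ hc b)
  have if2 : ∀ b, Integrable fun x => f2 b x * φ x := fun b => i (cf2 b) hφ.continuous hc
  have i0 : Integrable fun x => κ ^ 2 * betaSq m * (f x * φ x) :=
    (i cf hφ.continuous hc).const_mul _
  calc ∫ x, f x * convOp κ m φ x
      = ∫ x, ((∑ i, f x * lineDeriv₂ (EuclideanSpace.single i 1) φ x - f x * lineDeriv₂ m φ x)
          + κ ^ 2 * betaSq m * (f x * φ x)) := by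
        refine integral_congr_ae (Eventually.of_forall fun x => ?_)
        simp only [convOp]
        rw [mul_add, mul_sub, Finset.mul_sum]
        ring
    _ = ∫ x, ((∑ i, f2 (EuclideanSpace.single i 1) x * φ x - f2 m x * φ x)
          + κ ^ 2 * betaSq m * (f x * φ x)) := by
        rw [integral_add _ i0, integral_add _ i0, integral_sub _ (id2 m), integral_sub _ (if2 m),
          integral_finsetSum _ (fun i _ => id2 _), integral_finsetSum _ (fun i _ => if2 _)]
        · simp only [ibp]
        · exact integrable_finsetSum _ fun i _ => if2 _
        · exact integrable_finsetSum _ fun i _ => id2 _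
        · exact (integrable_finsetSum _ fun i _ => if2 _).sub (if2 _)
        · exact (integrable_finsetSum _ fun i _ => id2 _).sub (id2 _)
    _ = _ := by
        refine integral_congr_ae (Eventually.of_forall fun x => ?_)
        have hs : 0 < machBilin m (x - y) (x - y) + ε :=
          add_pos_of_nonneg_of_pos (machBilin_self_nonneg hm _) hε
        have e1 := congrArg (fun t : ℝ => (t : ℂ)) (sum_machBilin_single_sq m (x - y))
        have e2 := congrArg (fun t : ℝ => (t : ℂ)) (sum_machBilin_single_single m)
        have e3 := hF.ode _ hs
        simp only [f, f2]
        push_cast at e1 e2 e3 ⊢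
        rw [← Finset.sum_mul, Finset.sum_add_distrib, ← Finset.mul_sum]
        simp only [mul_assoc]
        rw [← Finset.mul_sum]
        have e4 : ∑ i : Fin d, (2 * ((machBilin m (x - y) (EuclideanSpace.single i 1) : ℂ) *
            (2 * (machBilin m (x - y) (EuclideanSpace.single i 1) : ℂ))))
            = 4 * ∑ i : Fin d, (machBilin m (x - y) (EuclideanSpace.single i 1) : ℂ) ^ 2 := by
          rw [Finset.mul_sum]
          exact Finset.sum_congr rfl fun i _ => by ring
        rw [e4, ← Finset.mul_sum]
        set X := F ((machBilin m (x - y) (x - y) : ℂ) + ε)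
        set X1 := F1 ((machBilin m (x - y) (x - y) : ℂ) + ε)
        set X2 := F2 ((machBilin m (x - y) (x - y) : ℂ) + ε)
        -- The operator produces β² (4 q F'' + 2 d F' + κ² F) at s = q + ε, where q = |x - y|_m².
        -- The radial equation at s removes everything except -4 β² ε F''.
        linear_combination 4 * X2 * φ x * e1 + 2 * X1 * φ x * e2 + betaSq m * φ x * e3

end Profile

end ConvectedHelmholtz

/-! ### Removing the regularisation: the fundamental solution -/

namespace ConvectedHelmholtz

open Filter Topology Complex
open scoped ContDiff

variable {d : ℕ}

/-- A continuous function on `(0, ∞)` with a limit at `0` is bounded on `(0, S]`. -/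
theorem exists_bound_of_tendsto_nhdsGT_zero {h : ℝ → ℂ} (hc : ContinuousOn h (Set.Ioi 0)) {c : ℂ}
    (hl : Tendsto h (𝓝[>] 0) (𝓝 c)) (S : ℝ) :
    ∃ C : ℝ, 0 ≤ C ∧ ∀ s, 0 < s → s ≤ S → ‖h s‖ ≤ C := by
  have h1 : ∀ᶠ s in 𝓝[>] (0 : ℝ), ‖h s‖ ≤ ‖c‖ + 1 :=
    hl.norm.eventually (eventually_le_nhds (lt_add_one _))
  obtain ⟨u, hu, hus⟩ := (mem_nhdsGT_iff_exists_Ioo_subset).1 h1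
  have hu0 : (0 : ℝ) < u := hu
  have hsub : Set.Icc u S ⊆ Set.Ioi (0 : ℝ) := fun s hs => hu0.trans_le hs.1
  obtain ⟨C, hC⟩ := isCompact_Icc.exists_bound_of_continuousOn (hc.mono hsub)
  refine ⟨max (‖c‖ + 1) C, le_max_of_le_left (by positivity), fun s hs0 hsS => ?_⟩
  rcases lt_or_ge s u with hsu | hsu
  · exact (hus ⟨hs0, hsu⟩).trans (le_max_left _ _)
  · exact (hC s ⟨hsu, hsS⟩).trans (le_max_right _ _)

section Profile

variable {κ : ℝ} {m : EuclideanSpace ℝ (Fin d)} {F F1 F2 : ℂ → ℂ}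

theorem continuousOn_comp_ofReal {G : ℂ → ℂ} (hG : ContinuousOn G slitPlane) :
    ContinuousOn (fun s : ℝ => G s) (Set.Ioi 0) :=
  hG.comp continuous_ofReal.continuousOn fun _ hs => ofReal_mem_slitPlane' hs

/-- The regularised potentials of a density vanishing near `y` converge at `y`. -/
theorem IsRadialProfile.tendsto_integral_regularized (hF : IsRadialProfile d κ F F1 F2)
    (hm : ‖m‖ < 1) {ψ : EuclideanSpace ℝ (Fin d) → ℂ} (hψ : Continuous ψ)
    (hc : HasCompactSupport ψ) {y : EuclideanSpace ℝ (Fin d)} (hy : ψ =ᶠ[𝓝 y] 0) :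
    Tendsto (fun ε : ℝ => ∫ x, F ((machBilin m (x - y) (x - y) + ε ^ 2 : ℝ) : ℂ) * ψ x) (𝓝[>] 0)
      (𝓝 (∫ x, F ((machBilin m (x - y) (x - y) : ℝ) : ℂ) * ψ x)) := by
  obtain ⟨δ, hδ, hball⟩ := Metric.eventually_nhds_iff.1 hy
  -- On the support of ψ the distance to y is at least δ, so for ε < 1 the arguments of F stay in a
  -- compact subset of (0, ∞).
  have hq : ∀ x, ψ x ≠ 0 → betaSq m * δ ^ 2 ≤ machBilin m (x - y) (x - y) := by
    intro x hx
    have h1 : δ ≤ ‖x - y‖ := by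
      by_contra h
      exact hx (hball (by rw [dist_eq_norm]; exact not_le.1 h))
    refine le_trans ?_ (le_machBilin_self m (x - y))
    have := (betaSq_pos hm).le
    gcongr
  have hq0 : 0 < betaSq m * δ ^ 2 := mul_pos (betaSq_pos hm) (by positivity)
  obtain ⟨S, hS⟩ := hc.isCompact.exists_bound_of_continuousOn
    (f := fun x => machBilin m (x - y) (x - y))
    ((continuous_machBilin_self m).comp (continuous_id.sub continuous_const)).continuousOn
  have hsub : Set.Icc (betaSq m * δ ^ 2) (S + 1) ⊆ Set.Ioi (0 : ℝ) := fun s hs => hq0.trans_le hs.1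
  obtain ⟨C, hC⟩ := isCompact_Icc.exists_bound_of_continuousOn
    ((continuousOn_comp_ofReal hF.continuousOn).mono hsub)
  refine tendsto_integral_filter_of_dominated_convergence (fun x => C * ‖ψ x‖) ?_ ?_ ?_ ?_
  · filter_upwards [self_mem_nhdsWithin] with ε hε
    have hε' : (0 : ℝ) < ε := hε
    exact ((continuous_comp_machBilin hF.continuousOn hm (pow_pos hε' 2) y).mul
      hψ).aestronglyMeasurable
  · filter_upwards [Ioo_mem_nhdsGT (zero_lt_one)] with ε hε
    refine Eventually.of_forall fun x => ?_
    rw [norm_mul]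
    by_cases hx : ψ x = 0
    · simp [hx]
    · refine mul_le_mul_of_nonneg_right (hC _ ⟨?_, ?_⟩) (norm_nonneg _)
      · exact (hq x hx).trans (le_add_of_nonneg_right (sq_nonneg _))
      · have h1 := (le_abs_self _).trans (hS x (subset_tsupport _ hx))
        have h2 : ε ^ 2 ≤ 1 := by nlinarith [hε.1, hε.2]
        exact add_le_add h1 h2
  · exact ((hψ.integrable_of_hasCompactSupport hc).norm).const_mul C
  · refine Eventually.of_forall fun x => ?_
    by_cases hx : ψ x = 0
    · simp [hx]
    · have hp : (0 : ℝ) < machBilin m (x - y) (x - y) := hq0.trans_le (hq x hx)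
      have hcont : ContinuousAt (fun s : ℝ => F s) (machBilin m (x - y) (x - y)) :=
        (continuousOn_comp_ofReal hF.continuousOn).continuousAt (Ioi_mem_nhds hp)
      have ht : Tendsto (fun ε : ℝ => machBilin m (x - y) (x - y) + ε ^ 2) (𝓝[>] 0)
          (𝓝 (machBilin m (x - y) (x - y))) := by
        have : Tendsto (fun ε : ℝ => machBilin m (x - y) (x - y) + ε ^ 2) (𝓝 0)
          (𝓝 (machBilin m (x - y) (x - y) + 0 ^ 2)) :=
          (continuous_const.add (continuous_id.pow 2)).tendsto 0
        simp only [ne_eq, OfNat.ofNat_ne_zero, not_false_eq_true, zero_pow, add_zero] at this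
        exact this.mono_left nhdsWithin_le_nhds
      exact (hcont.tendsto.comp ht).mul_const _

/-- Decay of order |z|^(-(d+2)) suffices in dimension d. This is the limiting shape of F'' after
rescaling around y. -/
theorem integrable_machBilin_rpow (hm : ‖m‖ < 1) :
    Integrable fun z : EuclideanSpace ℝ (Fin d) =>
      (1 + machBilin m z z) ^ (-(((d : ℝ) + 2) / 2)) := by
  have hb := betaSq_pos hm
  have hint := (integrable_rpow_neg_one_add_norm_sq (E := EuclideanSpace ℝ (Fin d)) (μ := volume)
    (r := (d : ℝ) + 2) (by rw [finrank_euclideanSpace_fin]; linarith)).const_mul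
      (betaSq m ^ (-(((d : ℝ) + 2) / 2)))
  refine hint.mono' ?_ (Eventually.of_forall fun z => ?_)
  · refine Continuous.aestronglyMeasurable (Continuous.rpow_const ?_ fun z => Or.inl ?_)
    · exact continuous_const.add (continuous_machBilin_self m)
    · have := machBilin_self_nonneg hm z
      positivity
  · have h0 := machBilin_self_nonneg hm z
    rw [Real.norm_of_nonneg (by positivity), neg_div, ← Real.mul_rpow hb.le (by positivity)]
    refine Real.rpow_le_rpow_of_nonpos (by positivity) ?_ (by
      rw [neg_nonpos]; positivity)
    have := le_machBilin_self m z
    have := betaSq_le_one m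
    nlinarith

/-- The regularised Laplacians of the fundamental solution form an approximate identity, up to a
factor. -/
theorem IsRadialProfile.tendsto_integral_approximate (hF : IsRadialProfile d κ F F1 F2)
    (hm : ‖m‖ < 1) {c : ℂ}
    (hcl : Tendsto (fun s : ℝ => ((s ^ (((d : ℝ) + 2) / 2) : ℝ) : ℂ) * F2 s) (𝓝[>] 0) (𝓝 c))
    {φ : EuclideanSpace ℝ (Fin d) → ℂ} (hφ : Continuous φ) (hc : HasCompactSupport φ)
    (y : EuclideanSpace ℝ (Fin d)) :
    Tendsto (fun ε : ℝ => ((ε ^ 2 : ℝ) : ℂ) *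
        ∫ x, F2 ((machBilin m (x - y) (x - y) + ε ^ 2 : ℝ) : ℂ) * φ x) (𝓝[>] 0)
      (𝓝 (c * ((∫ z : EuclideanSpace ℝ (Fin d),
        (1 + machBilin m z z) ^ (-(((d : ℝ) + 2) / 2)) : ℝ) : ℂ) * φ y)) := by
  set p : ℝ := ((d : ℝ) + 2) / 2 with hp
  let H : ℝ → ℂ := fun s => ((s ^ p : ℝ) : ℂ) * F2 s
  have hHc : ContinuousOn H (Set.Ioi 0) := by
    refine ContinuousOn.mul (continuous_ofReal.comp_continuousOn fun s hs =>
      (Real.continuousAt_rpow_const s p (Or.inl (ne_of_gt hs))).continuousWithinAt)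
      (continuousOn_comp_ofReal hF.continuousOn_deriv2)
  have hq1 : ∀ z : EuclideanSpace ℝ (Fin d), 0 < 1 + machBilin m z z := fun z => by
    have := machBilin_self_nonneg hm z
    positivity
  obtain ⟨R, hR⟩ := hc.isCompact.exists_bound_of_continuousOn (f := fun x => machBilin m (x - y) (x - y))
    ((continuous_machBilin_self m).comp (continuous_id.sub continuous_const)).continuousOn
  obtain ⟨C, hC0, hC⟩ := exists_bound_of_tendsto_nhdsGT_zero hHc hcl (R + 1)
  obtain ⟨C', hC'⟩ := hc.exists_bound_of_continuous hφ
  -- Substituting x = y + ε z gives s = ε² (1 + |z|_m²); the factor s^p in `H`, with p = (d+2)/2,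
  -- absorbs exactly ε² and the Jacobian ε^d.
  have hchange : ∀ ε : ℝ, 0 < ε → ((ε ^ 2 : ℝ) : ℂ) *
        ∫ x, F2 ((machBilin m (x - y) (x - y) + ε ^ 2 : ℝ) : ℂ) * φ x
      = ∫ z : EuclideanSpace ℝ (Fin d), H (ε ^ 2 * (1 + machBilin m z z)) *
          (((1 + machBilin m z z) ^ (-p) : ℝ) : ℂ) * φ (y + ε • z) := by
    intro ε hε
    have e1 := integral_add_left_eq_self (μ := volume)
      (fun x => F2 ((machBilin m (x - y) (x - y) + ε ^ 2 : ℝ) : ℂ) * φ x) y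
    have e2 := Measure.integral_comp_smul_of_nonneg (volume : Measure (EuclideanSpace ℝ (Fin d)))
      (fun x => F2 ((machBilin m (y + x - y) (y + x - y) + ε ^ 2 : ℝ) : ℂ) * φ (y + x)) ε
      (hR := hε.le)
    rw [finrank_euclideanSpace_fin] at e2
    have hεd : ((ε ^ d : ℝ) : ℂ) ≠ 0 := by exact_mod_cast (pow_pos hε d).ne'
    have e3 : ∫ x, F2 ((machBilin m (x - y) (x - y) + ε ^ 2 : ℝ) : ℂ) * φ x
        = ((ε ^ d : ℝ) : ℂ) * ∫ z : EuclideanSpace ℝ (Fin d),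
          F2 ((machBilin m (y + ε • z - y) (y + ε • z - y) + ε ^ 2 : ℝ) : ℂ) * φ (y + ε • z) := by
      rw [e2, e1, real_smul, ofReal_inv, mul_inv_cancel_left₀ hεd]
    rw [e3, ← mul_assoc, ← integral_const_mul]
    refine integral_congr_ae (Eventually.of_forall fun z => ?_)
    have h1 : machBilin m (y + ε • z - y) (y + ε • z - y) + ε ^ 2
        = ε ^ 2 * (1 + machBilin m z z) := by
      rw [add_sub_cancel_left, machBilin_smul_smul]; ring
    have h2 : (ε ^ 2 * (1 + machBilin m z z)) ^ p * (1 + machBilin m z z) ^ (-p)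
        = ε ^ 2 * ε ^ d := by
      rw [Real.mul_rpow (by positivity) (hq1 z).le, mul_assoc, ← Real.rpow_add (hq1 z),
        add_neg_cancel, Real.rpow_zero, mul_one, ← pow_add, ← Real.rpow_natCast,
        ← Real.rpow_natCast, ← Real.rpow_mul hε.le]
      congr 1
      rw [hp]; push_cast; ring
    simp only [H]
    rw [h1, ← ofReal_mul, ← h2, ofReal_mul]
    ring
  have hlim : Tendsto (fun ε : ℝ => ∫ z : EuclideanSpace ℝ (Fin d),
        H (ε ^ 2 * (1 + machBilin m z z)) *
          (((1 + machBilin m z z) ^ (-p) : ℝ) : ℂ) * φ (y + ε • z)) (𝓝[>] 0)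
      (𝓝 (∫ z : EuclideanSpace ℝ (Fin d), c * (((1 + machBilin m z z) ^ (-p) : ℝ) : ℂ) * φ y)) := by
    refine tendsto_integral_filter_of_dominated_convergence
      (fun z => C * C' * (1 + machBilin m z z) ^ (-p)) ?_ ?_ ?_ ?_
    · filter_upwards [self_mem_nhdsWithin] with ε hε
      have hε' : (0 : ℝ) < ε := hε
      have c0 : Continuous fun z : EuclideanSpace ℝ (Fin d) => 1 + machBilin m z z :=
        continuous_const.add (continuous_machBilin_self m)
      refine Continuous.aestronglyMeasurable (Continuous.mul (Continuous.mul ?_ ?_) ?_)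
      · exact hHc.comp_continuous (continuous_const.mul c0)
          fun z => mul_pos (pow_pos hε' 2) (hq1 z)
      · exact continuous_ofReal.comp (c0.rpow_const fun z => Or.inl (hq1 z).ne')
      · exact hφ.comp (continuous_const.add (continuous_id.const_smul ε))
    · filter_upwards [Ioo_mem_nhdsGT (zero_lt_one)] with ε hε
      refine Eventually.of_forall fun z => ?_
      have hpos : (0 : ℝ) ≤ (1 + machBilin m z z) ^ (-p) := Real.rpow_nonneg (hq1 z).le _
      rw [norm_mul, norm_mul, norm_real, Real.norm_of_nonneg hpos]
      by_cases hx : φ (y + ε • z) = 0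
      · rw [hx, norm_zero, mul_zero]
        have : 0 ≤ C' := (norm_nonneg _).trans (hC' 0)
        positivity
      -- Where φ(y + ε z) ≠ 0 the argument of `H` is at most R + 1, the range on which `H` is
      -- bounded by C.
      · have h1 := (le_abs_self _).trans (hR _ (subset_tsupport _ hx))
        rw [add_sub_cancel_left, machBilin_smul_smul] at h1
        have h2 : ε ^ 2 ≤ 1 := by nlinarith [hε.1, hε.2]
        have h3 := hC (ε ^ 2 * (1 + machBilin m z z)) (mul_pos (pow_pos hε.1 2) (hq1 z))
          (by linarith)
        calc _ ≤ C * (1 + machBilin m z z) ^ (-p) * C' := by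
              gcongr
              exact hC' _
          _ = _ := by ring
    · exact (integrable_machBilin_rpow hm).const_mul _
    · refine Eventually.of_forall fun z => ?_
      have t1 : Tendsto (fun ε : ℝ => ε ^ 2 * (1 + machBilin m z z)) (𝓝[>] 0) (𝓝[>] 0) := by
        refine tendsto_nhdsWithin_iff.2 ⟨?_, ?_⟩
        · have : Tendsto (fun ε : ℝ => ε ^ 2 * (1 + machBilin m z z)) (𝓝 0)
            (𝓝 (0 ^ 2 * (1 + machBilin m z z))) :=
            ((continuous_id.pow 2).mul continuous_const).tendsto 0
          simp only [ne_eq, OfNat.ofNat_ne_zero, not_false_eq_true, zero_pow, zero_mul] at this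
          exact this.mono_left nhdsWithin_le_nhds
        · filter_upwards [self_mem_nhdsWithin] with ε hε
          exact mul_pos (pow_pos hε 2) (hq1 z)
      have t2 : Tendsto (fun ε : ℝ => φ (y + ε • z)) (𝓝[>] 0) (𝓝 (φ y)) := by
        have : Tendsto (fun ε : ℝ => φ (y + ε • z)) (𝓝 0) (𝓝 (φ (y + (0 : ℝ) • z))) :=
          (hφ.comp (continuous_const.add (continuous_id.smul continuous_const))).tendsto 0
        rw [zero_smul, add_zero] at this
        exact this.mono_left nhdsWithin_le_nhds
      exact ((hcl.comp t1).mul_const _).mul t2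
  rw [integral_mul_const, integral_const_mul, integral_complex_ofReal] at hlim
  refine hlim.congr' ?_
  filter_upwards [self_mem_nhdsWithin] with ε hε
  exact (hchange ε hε).symm

/-- `F (|x - y|²)` is, up to a nonzero factor, a fundamental solution. -/
theorem IsRadialProfile.exists_integral_eq (hF : IsRadialProfile d κ F F1 F2) (hm : ‖m‖ < 1) :
    ∃ K : ℂ, K ≠ 0 ∧ ∀ (φ : EuclideanSpace ℝ (Fin d) → ℂ) (y : EuclideanSpace ℝ (Fin d)),
      ContDiff ℝ ∞ φ → HasCompactSupport φ → convOp κ m φ =ᶠ[𝓝 y] 0 →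
      ∫ x, F ((machBilin m (x - y) (x - y) : ℝ) : ℂ) * convOp κ m φ x = K * φ y := by
  obtain ⟨c, hc0, hcl⟩ := hF.tendsto_deriv2
  have hI : 0 < ∫ z : EuclideanSpace ℝ (Fin d), (1 + machBilin m z z) ^ (-(((d : ℝ) + 2) / 2)) := by
    have hpos : ∀ z : EuclideanSpace ℝ (Fin d),
        0 < (1 + machBilin m z z) ^ (-(((d : ℝ) + 2) / 2)) := fun z =>
      Real.rpow_pos_of_pos (by have := machBilin_self_nonneg hm z; positivity) _
    rw [integral_pos_iff_support_of_nonneg (fun z => (hpos z).le) (integrable_machBilin_rpow hm)]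
    have : Function.support (fun z : EuclideanSpace ℝ (Fin d) =>
        (1 + machBilin m z z) ^ (-(((d : ℝ) + 2) / 2))) = Set.univ :=
      Set.eq_univ_of_forall fun z => (hpos z).ne'
    rw [this]
    exact isOpen_univ.measure_pos _ Set.univ_nonempty
  refine ⟨-(4 * betaSq m) * (c * ((∫ z : EuclideanSpace ℝ (Fin d),
        (1 + machBilin m z z) ^ (-(((d : ℝ) + 2) / 2)) : ℝ) : ℂ)), ?_, fun φ y hφ hc hy => ?_⟩
  · have h1 : (betaSq m : ℂ) ≠ 0 := by exact_mod_cast (betaSq_pos hm).ne'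
    have h2 := hI.ne'
    refine mul_ne_zero (neg_ne_zero.2 (mul_ne_zero (by norm_num) h1)) (mul_ne_zero hc0 ?_)
    exact_mod_cast h2
  -- Since `convOp κ m φ` vanishes near y, this limit never meets the singularity. Green's identity
  -- with ε² equates it with the approximate-identity limit, which fixes K.
  · have l1 := hF.tendsto_integral_regularized hm (continuous_convOp hφ κ m)
      (hasCompactSupport_convOp hc κ m) hy
    have l2 := (hF.tendsto_integral_approximate hm hcl hφ.continuous hc y).const_mul
      (-(4 * betaSq m) : ℂ)
    rw [mul_assoc (-(4 * betaSq m) : ℂ)]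
    refine tendsto_nhds_unique (l1.congr' ?_) l2
    filter_upwards [self_mem_nhdsWithin] with ε hε
    have hε' : (0 : ℝ) < ε := hε
    rw [hF.integral_mul_convOp hm hφ hc (pow_pos hε' 2) y, ← mul_assoc, ← integral_const_mul]
    refine integral_congr_ae (Eventually.of_forall fun x => ?_)
    simp only []
    push_cast
    ring

end Profile

end ConvectedHelmholtz

/-! ### Unique continuation of the potential in the exterior -/

namespace ConvectedHelmholtz

open Filter Topology Complex
open scoped ContDiff

variable {d : ℕ}

section Continuation

variable {κ : ℝ} {m : EuclideanSpace ℝ (Fin d)} {F F1 F2 : ℂ → ℂ}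

theorem continuousOn_comp_machBilin_sub {G : ℂ → ℂ} (hG : ContinuousOn G slitPlane) (hm : ‖m‖ < 1) :
    ContinuousOn (fun z : EuclideanSpace ℝ (Fin d) × EuclideanSpace ℝ (Fin d) =>
      G ((machBilin m (z.1 - z.2) (z.1 - z.2) : ℝ) : ℂ)) {z | z.1 ≠ z.2} :=
  hG.comp (continuous_ofReal.comp ((continuous_machBilin_self m).comp
    (continuous_fst.sub continuous_snd))).continuousOn
    fun _ hz => ofReal_mem_slitPlane' (machBilin_self_pos hm (sub_ne_zero.2 hz))

theorem aestronglyMeasurable_comp_machBilin_sub {G : ℂ → ℂ} (hG : ContinuousOn G slitPlane)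
    (hm : ‖m‖ < 1) {Ω : Set (EuclideanSpace ℝ (Fin d))} (hΩ : IsOpen Ω)
    {x : EuclideanSpace ℝ (Fin d)} (hx : x ∉ Ω) :
    AEStronglyMeasurable (fun y => G ((machBilin m (x - y) (x - y) : ℝ) : ℂ))
      (volume.restrict Ω) := by
  have hc : ContinuousOn (fun y : EuclideanSpace ℝ (Fin d) => (x, y)) Ω := by fun_prop
  have h := ContinuousOn.comp (f := fun y : EuclideanSpace ℝ (Fin d) => (x, y))
    (continuousOn_comp_machBilin_sub hG hm) hc fun y hy h => hx (by
      have : x = y := h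
      rwa [this])
  exact h.aestronglyMeasurable hΩ.measurableSet

/-- The potential of an integrable density is continuous away from the support. -/
theorem continuousOn_potential {G : ℂ → ℂ} (hG : ContinuousOn G slitPlane) (hm : ‖m‖ < 1)
    {Ω : Set (EuclideanSpace ℝ (Fin d))} (hΩ : IsOpen Ω) (hb : Bornology.IsBounded Ω)
    {v : EuclideanSpace ℝ (Fin d) → ℂ} (hv : IntegrableOn v Ω) :
    ContinuousOn (fun x => ∫ y in Ω, G ((machBilin m (x - y) (x - y) : ℝ) : ℂ) * v y)
      (closure Ω)ᶜ := by
  intro x₁ hx₁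
  refine ContinuousAt.continuousWithinAt ?_
  obtain ⟨ρ, hρ, hball⟩ := Metric.nhds_basis_closedBall.mem_iff.1
    (isClosed_closure.isOpen_compl.mem_nhds hx₁)
  obtain ⟨C, hC⟩ := ((isCompact_closedBall x₁ ρ).prod hb.isCompact_closure).exists_bound_of_continuousOn
    ((continuousOn_comp_machBilin_sub hG hm).mono fun z hz h => hball hz.1 (by
      have : z.1 = z.2 := h
      rw [this]; exact hz.2))
  have hnear : ∀ᶠ x in 𝓝 x₁, x ∈ Metric.closedBall x₁ ρ := Metric.closedBall_mem_nhds x₁ hρ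
  refine continuousAt_of_dominated (bound := fun y => C * ‖v y‖) ?_ ?_ (hv.norm.const_mul C) ?_
  · filter_upwards [hnear] with x hx
    exact (aestronglyMeasurable_comp_machBilin_sub hG hm hΩ
      fun h => hball hx (subset_closure h)).mul hv.aestronglyMeasurable
  · filter_upwards [hnear] with x hx
    refine (ae_restrict_iff' hΩ.measurableSet).2 (Eventually.of_forall fun y hy => ?_)
    rw [norm_mul]
    exact mul_le_mul_of_nonneg_right (hC (x, y) ⟨hx, subset_closure hy⟩) (norm_nonneg _)
  · refine (ae_restrict_iff' hΩ.measurableSet).2 (Eventually.of_forall fun y hy => ?_)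
    have hne : x₁ ≠ y := fun h => hx₁ (h ▸ subset_closure hy)
    have h1 : ContinuousAt (fun x => machBilin m (x - y) (x - y)) x₁ :=
      ((continuous_machBilin_self m).comp (continuous_id.sub continuous_const)).continuousAt
    have h2 : ContinuousAt (fun s : ℝ => G s) (machBilin m (x₁ - y) (x₁ - y)) :=
      (continuousOn_comp_ofReal hG).continuousAt
        (Ioi_mem_nhds (machBilin_self_pos hm (sub_ne_zero.2 hne)))
    exact (ContinuousAt.comp (f := fun x => machBilin m (x - y) (x - y)) (x := x₁) h2 h1).mul
      continuousAt_const

/-- The restriction of the potential to a short segment extends holomorphically, so it vanishes if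
it vanishes near an endpoint. -/
theorem IsRadialProfile.potential_segment_eq_zero (hF : IsRadialProfile d κ F F1 F2)
    (hm : ‖m‖ < 1) {Ω : Set (EuclideanSpace ℝ (Fin d))} (hΩ : IsOpen Ω)
    (hb : Bornology.IsBounded Ω) {v : EuclideanSpace ℝ (Fin d) → ℂ} (hv : IntegrableOn v Ω)
    {p e : EuclideanSpace ℝ (Fin d)}
    (hpe : ∀ y ∈ closure Ω, 4 * (‖p - y‖ * ‖e‖) + 4 * ‖e‖ ^ 2 < betaSq m * ‖p - y‖ ^ 2)
    (h0 : (fun x => ∫ y in Ω, F ((machBilin m (x - y) (x - y) : ℝ) : ℂ) * v y) =ᶠ[𝓝 p] 0) :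
    ∫ y in Ω, F ((machBilin m (p + e - y) (p + e - y) : ℝ) : ℂ) * v y = 0 := by
  -- The polynomial extension of |p + t e - y|_m² to complex t. By `hpe` its real part stays
  -- positive for |t| ≤ 2, so F can be composed with it.
  let P : ℂ → EuclideanSpace ℝ (Fin d) → ℂ := fun t y =>
    (machBilin m (p - y) (p - y) : ℂ) + 2 * t * (machBilin m (p - y) e : ℂ)
      + t ^ 2 * (machBilin m e e : ℂ)
  let P1 : ℂ → EuclideanSpace ℝ (Fin d) → ℂ := fun t y =>
    2 * (machBilin m (p - y) e : ℂ) + 2 * t * (machBilin m e e : ℂ)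
  have hPs : ∀ t : ℂ, ‖t‖ ≤ 2 → ∀ y ∈ closure Ω, P t y ∈ slitPlane := by
    intro t ht y hy
    rw [mem_slitPlane_iff]
    left
    have h1 := hpe y hy
    have h2 := le_machBilin_self m (p - y)
    have h3 := abs_machBilin_le hm (p - y) e
    have h4 := abs_machBilin_le hm e e
    have h5 : ‖2 * t * (machBilin m (p - y) e : ℂ) + t ^ 2 * (machBilin m e e : ℂ)‖
        ≤ 4 * (‖p - y‖ * ‖e‖) + 4 * ‖e‖ ^ 2 := by
      refine (norm_add_le _ _).trans (add_le_add ?_ ?_)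
      · rw [norm_mul, norm_mul, norm_real, Real.norm_eq_abs, Complex.norm_ofNat]
        gcongr
        linarith
      · rw [norm_mul, norm_pow, norm_real, Real.norm_eq_abs]
        have : ‖t‖ ^ 2 ≤ 4 := by nlinarith [norm_nonneg t]
        have h6 : |machBilin m e e| ≤ ‖e‖ ^ 2 := by rw [sq]; exact h4
        gcongr
    have h6 := (abs_le.1 ((abs_re_le_norm _).trans h5)).1
    have h7 : (P t y).re = machBilin m (p - y) (p - y)
        + (2 * t * (machBilin m (p - y) e : ℂ) + t ^ 2 * (machBilin m e e : ℂ)).re := by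
      simp only [P, add_assoc]
      rw [add_re, ofReal_re]
    rw [h7]
    linarith
  have hPt : ∀ t y, HasDerivAt (fun t => P t y) (P1 t y) t := by
    intro t y
    have h := ((((hasDerivAt_id t).const_mul 2).mul_const (machBilin m (p - y) e : ℂ)).const_add
      (machBilin m (p - y) (p - y) : ℂ)).add (((hasDerivAt_id t).pow 2).mul_const
        (machBilin m e e : ℂ))
    convert! h using 1
    simp [P1]
  have hPr : ∀ (t : ℝ) y, P t y = ((machBilin m (p + t • e - y) (p + t • e - y) : ℝ) : ℂ) := by
    intro t y
    rw [add_sub_right_comm, machBilin_add_smul]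
    simp only [P]
    push_cast
    ring
  have cB : Continuous fun z : ℂ × EuclideanSpace ℝ (Fin d) =>
      ((machBilin m (p - z.2) (p - z.2) : ℝ) : ℂ) :=
    continuous_ofReal.comp ((continuous_machBilin_self m).comp (continuous_const.sub continuous_snd))
  have cB' : Continuous fun z : ℂ × EuclideanSpace ℝ (Fin d) =>
      ((machBilin m (p - z.2) e : ℝ) : ℂ) :=
    continuous_ofReal.comp
      ((continuous_machBilin_left m e).comp (continuous_const.sub continuous_snd))
  have cP : Continuous fun z : ℂ × EuclideanSpace ℝ (Fin d) => P z.1 z.2 := by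
    exact (cB.add ((continuous_const.mul continuous_fst).mul cB')).add
      ((continuous_fst.pow 2).mul continuous_const)
  have cP1 : Continuous fun z : ℂ × EuclideanSpace ℝ (Fin d) => P1 z.1 z.2 := by
    exact (continuous_const.mul cB').add ((continuous_const.mul continuous_fst).mul continuous_const)
  have hK : IsCompact (Metric.closedBall (0 : ℂ) 2 ×ˢ closure Ω) :=
    (isCompact_closedBall _ _).prod hb.isCompact_closure
  have hmaps : Set.MapsTo (fun z : ℂ × EuclideanSpace ℝ (Fin d) => P z.1 z.2)
      (Metric.closedBall (0 : ℂ) 2 ×ˢ closure Ω) slitPlane :=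
    fun z hz => hPs z.1 (mem_closedBall_zero_iff.1 hz.1) z.2 hz.2
  have cF : ContinuousOn (fun z : ℂ × EuclideanSpace ℝ (Fin d) => F (P z.1 z.2))
      (Metric.closedBall (0 : ℂ) 2 ×ˢ closure Ω) := hF.continuousOn.comp cP.continuousOn hmaps
  have cF1 : ContinuousOn (fun z : ℂ × EuclideanSpace ℝ (Fin d) => F1 (P z.1 z.2) * P1 z.1 z.2)
      (Metric.closedBall (0 : ℂ) 2 ×ˢ closure Ω) :=
    (hF.continuousOn_deriv.comp cP.continuousOn hmaps).mul cP1.continuousOn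
  obtain ⟨C, hC⟩ := hK.exists_bound_of_continuousOn cF
  obtain ⟨C1, hC1⟩ := hK.exists_bound_of_continuousOn cF1
  have meas : ∀ {u : ℂ × EuclideanSpace ℝ (Fin d) → ℂ},
      ContinuousOn u (Metric.closedBall (0 : ℂ) 2 ×ˢ closure Ω) → ∀ t ∈ Metric.ball (0 : ℂ) 2,
      AEStronglyMeasurable (fun y => u (t, y) * v y) (volume.restrict Ω) := by
    intro u hu t ht
    have hc : ContinuousOn (fun y : EuclideanSpace ℝ (Fin d) => (t, y)) Ω := by fun_prop
    have h := ContinuousOn.comp (f := fun y : EuclideanSpace ℝ (Fin d) => (t, y)) hu hc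
      fun y hy => ⟨Metric.ball_subset_closedBall ht, subset_closure hy⟩
    exact (h.aestronglyMeasurable hΩ.measurableSet).mul hv.aestronglyMeasurable
  have bd : ∀ {u : ℂ × EuclideanSpace ℝ (Fin d) → ℂ} {C : ℝ},
      (∀ z ∈ Metric.closedBall (0 : ℂ) 2 ×ˢ closure Ω, ‖u z‖ ≤ C) →
      ∀ᵐ y ∂volume.restrict Ω, ∀ t ∈ Metric.ball (0 : ℂ) 2, ‖u (t, y) * v y‖ ≤ C * ‖v y‖ := by
    intro u C hu
    refine (ae_restrict_iff' hΩ.measurableSet).2 (Eventually.of_forall fun y hy t ht => ?_)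
    rw [norm_mul]
    exact mul_le_mul_of_nonneg_right
      (hu (t, y) ⟨Metric.ball_subset_closedBall ht, subset_closure hy⟩) (norm_nonneg _)
  let W : ℂ → ℂ := fun t => ∫ y in Ω, F (P t y) * v y
  have hW : ∀ t ∈ Metric.ball (0 : ℂ) 2,
      HasDerivAt W (∫ y in Ω, F1 (P t y) * P1 t y * v y) t := by
    intro t ht
    refine (hasDerivAt_integral_of_dominated_loc_of_deriv_le (bound := fun y => C1 * ‖v y‖)
      (F' := fun t y => F1 (P t y) * P1 t y * v y)
      (Metric.isOpen_ball.mem_nhds ht) ?_ ?_ ?_ ?_ (hv.norm.const_mul C1) ?_).2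
    · filter_upwards [Metric.isOpen_ball.mem_nhds ht] with t' ht'
      exact meas (u := fun z => F (P z.1 z.2)) cF t' ht'
    · refine (hv.norm.const_mul C).mono' (meas (u := fun z => F (P z.1 z.2)) cF t ht) ?_
      filter_upwards [bd (u := fun z => F (P z.1 z.2)) hC] with y hy
      exact hy t ht
    · exact meas (u := fun z => F1 (P z.1 z.2) * P1 z.1 z.2) cF1 t ht
    · exact bd (u := fun z => F1 (P z.1 z.2) * P1 z.1 z.2) hC1
    · refine (ae_restrict_iff' hΩ.measurableSet).2 (Eventually.of_forall fun y hy t' ht' => ?_)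
      exact ((hF.hasDerivAt _ (hPs t' (mem_ball_zero_iff.1 ht').le y
        (subset_closure hy))).comp t' (hPt t' y)).mul_const _
  have hWa : AnalyticOnNhd ℂ W (Metric.ball 0 2) :=
    DifferentiableOn.analyticOnNhd
      (fun t ht => (hW t ht).differentiableAt.differentiableWithinAt) Metric.isOpen_ball
  have hW0 : ∀ᶠ t : ℝ in 𝓝 0, W t = 0 := by
    have hc : Tendsto (fun t : ℝ => p + t • e) (𝓝 0) (𝓝 p) := by
      have : Tendsto (fun t : ℝ => p + t • e) (𝓝 0) (𝓝 (p + (0 : ℝ) • e)) :=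
        (continuous_const.add (continuous_id.smul continuous_const)).tendsto 0
      rwa [zero_smul, add_zero] at this
    filter_upwards [hc.eventually h0] with t ht
    simp only [W, hPr]
    exact ht
  -- The real zeros accumulate at 0, so W vanishes on the disc of radius 2, which contains the
  -- endpoint t = 1.
  have hfreq : ∃ᶠ t : ℂ in 𝓝[≠] 0, W t = 0 := by
    have hT : Tendsto (fun t : ℝ => (t : ℂ)) (𝓝[≠] 0) (𝓝[≠] 0) := by
      refine tendsto_nhdsWithin_iff.2 ⟨?_, ?_⟩
      · have := continuous_ofReal.tendsto 0
        rw [ofReal_zero] at this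
        exact this.mono_left nhdsWithin_le_nhds
      · filter_upwards [self_mem_nhdsWithin] with t ht
        simpa using ht
    exact hT.frequently (hW0.filter_mono nhdsWithin_le_nhds).frequently
  have h1 := hWa.eqOn_zero_of_preconnected_of_frequently_eq_zero
    (convex_ball (0 : ℂ) 2).isPreconnected (Metric.mem_ball_self two_pos) hfreq
  have h2 : W ((1 : ℝ) : ℂ) = 0 := h1 (by simp)
  simp only [W, hPr, one_smul] at h2
  exact h2

/-- Unique continuation for the potential outside the support of the density. -/
theorem IsRadialProfile.potential_eq_zero (hF : IsRadialProfile d κ F F1 F2)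
    (hm : ‖m‖ < 1) {Ω M : Set (EuclideanSpace ℝ (Fin d))} (hΩ : IsOpen Ω)
    (hb : Bornology.IsBounded Ω) (hcompl : IsPreconnected (closure Ω)ᶜ) (hM : IsOpen M)
    (hMn : M.Nonempty) (hMs : M ⊆ (closure Ω)ᶜ)
    {v : EuclideanSpace ℝ (Fin d) → ℂ} (hv : IntegrableOn v Ω)
    (h0 : ∀ᵐ x ∂volume.restrict M,
      ∫ y in Ω, F ((machBilin m (x - y) (x - y) : ℝ) : ℂ) * v y = 0)
    {x : EuclideanSpace ℝ (Fin d)} (hx : x ∈ (closure Ω)ᶜ) :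
    ∫ y in Ω, F ((machBilin m (x - y) (x - y) : ℝ) : ℂ) * v y = 0 := by
  set w : EuclideanSpace ℝ (Fin d) → ℂ :=
    fun x => ∫ y in Ω, F ((machBilin m (x - y) (x - y) : ℝ) : ℂ) * v y with hw
  have hwc : ContinuousOn w (closure Ω)ᶜ := continuousOn_potential hF.continuousOn hm hΩ hb hv
  have hM0 : Set.EqOn w 0 M :=
    Measure.eqOn_open_of_ae_eq h0 hM (hwc.mono hMs) continuousOn_const
  -- The set of points near which w vanishes is open, meets the exterior, and is relatively closed
  -- there by the segment lemma.
  have hmain : (closure Ω)ᶜ ⊆ {x | ∀ᶠ x' in 𝓝 x, w x' = 0} := by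
    refine hcompl.subset_of_closure_inter_subset isOpen_setOfPred_eventually_nhds ?_ ?_
    · obtain ⟨x, hx⟩ := hMn
      exact ⟨x, hMs hx, Filter.eventually_of_mem (hM.mem_nhds hx) fun y hy => hM0 hy⟩
    · rintro x₁ ⟨hx₁c, hx₁⟩
      obtain ⟨ρ, hρ, hball⟩ := Metric.nhds_basis_ball.mem_iff.1
        (isClosed_closure.isOpen_compl.mem_nhds hx₁)
      have hβ := betaSq_pos hm
      have hβ1 := betaSq_le_one m
      -- If p and q lie within β²ρ/64 of x₁, then |p - y| ≥ ρ/2 and |q - p| ≤ β² |p - y|/16. The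
      -- left side of the segment condition is then at most (1/4 + 1/64) β² |p - y|².
      have hη : 0 < betaSq m * ρ / 64 := by positivity
      have hη1 : betaSq m * ρ / 64 ≤ ρ / 64 := by nlinarith
      obtain ⟨p, hp, hpx⟩ := Metric.mem_closure_iff.1 hx₁c _ hη
      refine Filter.eventually_of_mem (Metric.ball_mem_nhds x₁ hη) fun q hq => ?_
      have hseg := hF.potential_segment_eq_zero hm hΩ hb hv (p := p) (e := q - p) ?_ hp
      · simpa [hw] using hseg
      · intro y hy
        have h1 : ρ ≤ dist y x₁ := by
          by_contra h
          exact hball (Metric.mem_ball.2 (not_le.1 h)) hy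
        have h2 : ‖q - p‖ < betaSq m * ρ / 32 := by
          have := dist_triangle q x₁ p
          rw [← dist_eq_norm]
          linarith [Metric.mem_ball.1 hq]
        have h3 : ρ / 2 ≤ ‖p - y‖ := by
          have := dist_triangle y p x₁
          rw [← dist_eq_norm, dist_comm p y]
          rw [dist_comm p x₁] at this
          linarith
        have h4 : ‖q - p‖ ≤ betaSq m * ‖p - y‖ / 16 := by nlinarith
        have h5 : 0 < ‖p - y‖ := by linarith
        have h6 : 4 * (‖p - y‖ * ‖q - p‖) ≤ betaSq m * ‖p - y‖ ^ 2 / 4 := by nlinarith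
        have h7 : ‖q - p‖ ^ 2 ≤ (betaSq m * ‖p - y‖ / 16) ^ 2 :=
          pow_le_pow_left₀ (norm_nonneg _) h4 2
        have h8 : betaSq m ^ 2 * ‖p - y‖ ^ 2 ≤ betaSq m * ‖p - y‖ ^ 2 := by
          have : betaSq m ^ 2 ≤ betaSq m := by nlinarith
          gcongr
        have h9 : 0 < betaSq m * ‖p - y‖ ^ 2 := by positivity
        nlinarith
  exact (hmain hx).self_of_nhds

end Continuation

end ConvectedHelmholtz

/-! ### Boundedness of the volume potential -/

namespace ConvectedHelmholtz

open Filter Topology Complex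
open scoped ContDiff

section IntegralOperator

open scoped NNReal ENNReal

variable {α β : Type*} [MeasurableSpace α] [MeasurableSpace β] {μ : Measure α} {ν : Measure β}

/-- A kernel whose sections have uniformly bounded `L²` norm defines a bounded operator on `L²`
spaces, if the target measure is finite. -/
theorem exists_integralOperator [IsFiniteMeasure μ] [SFinite ν] {K : α → β → ℂ}
    (hKm : AEStronglyMeasurable (Function.uncurry K) (μ.prod ν)) {C : ℝ≥0}
    (hK : ∀ᵐ x ∂μ, MemLp (K x) 2 ν ∧ eLpNorm (K x) 2 ν ≤ C) :
    ∃ G : Lp ℂ 2 ν →L[ℂ] Lp ℂ 2 μ, ∀ v : Lp ℂ 2 ν, ∀ᵐ x ∂μ,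
      Integrable (fun y => K x y * v y) ν ∧ G v x = ∫ y, K x y * v y ∂ν := by
  have hint : ∀ v : Lp ℂ 2 ν, ∀ᵐ x ∂μ, Integrable (fun y => K x y * v y) ν := by
    intro v
    filter_upwards [hK] with x hx
    exact hx.1.integrable_mul (Lp.memLp v)
  -- Cauchy–Schwarz gives a uniform pointwise bound; finiteness of μ then converts it into an L²
  -- bound.
  have hbd : ∀ v : Lp ℂ 2 ν, ∀ᵐ x ∂μ, ‖∫ y, K x y * v y ∂ν‖ ≤ C * ‖v‖ := by
    intro v
    filter_upwards [hK] with x hx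
    have h1 : ‖∫ y, K x y * v y ∂ν‖ₑ ≤ C * ‖v‖ₑ := by
      refine (enorm_integral_le_lintegral_enorm _).trans ?_
      rw [← eLpNorm_one_eq_lintegral_enorm]
      refine (eLpNorm_smul_le_mul_eLpNorm (p := 2) (q := 2) (r := 1) (φ := K x) (f := v)
        (Lp.aestronglyMeasurable v) hx.1.aestronglyMeasurable).trans ?_
      rw [Lp.enorm_def]
      exact mul_le_mul_left hx.2 _
    have h2 : (C : ℝ≥0∞) * ‖v‖ₑ = ENNReal.ofReal (C * ‖v‖) := by
      rw [ENNReal.ofReal_mul C.coe_nonneg, ofReal_norm, ENNReal.ofReal_coe_nnreal]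
    rw [h2, ← ofReal_norm] at h1
    exact (ENNReal.ofReal_le_ofReal_iff (by positivity)).1 h1
  have hmem : ∀ v : Lp ℂ 2 ν, MemLp (fun x => ∫ y, K x y * v y ∂ν) 2 μ := by
    intro v
    refine MemLp.of_bound ?_ _ (hbd v)
    exact (hKm.mul (Lp.aestronglyMeasurable v).comp_snd).integral_prod_right'
  let T : Lp ℂ 2 ν →ₗ[ℂ] Lp ℂ 2 μ :=
    { toFun := fun v => (hmem v).toLp _
      map_add' := fun v w => by
        refine Lp.ext ?_
        filter_upwards [(hmem (v + w)).coeFn_toLp, (hmem v).coeFn_toLp, (hmem w).coeFn_toLp,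
          Lp.coeFn_add ((hmem v).toLp _) ((hmem w).toLp _), hint v, hint w] with x h1 h2 h3 h4 h5 h6
        rw [h1, h4, Pi.add_apply, h2, h3, ← integral_add h5 h6]
        refine integral_congr_ae ?_
        filter_upwards [Lp.coeFn_add v w] with y hy
        rw [hy, Pi.add_apply, mul_add]
      map_smul' := fun c v => by
        refine Lp.ext ?_
        filter_upwards [(hmem (c • v)).coeFn_toLp, (hmem v).coeFn_toLp,
          Lp.coeFn_smul c ((hmem v).toLp _)] with x h1 h2 h3
        rw [h1, RingHom.id_apply, h3, Pi.smul_apply, h2, smul_eq_mul, ← integral_const_mul]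
        refine integral_congr_ae ?_
        filter_upwards [Lp.coeFn_smul c v] with y hy
        rw [hy, Pi.smul_apply, smul_eq_mul, mul_left_comm] }
  have hT : ∀ v, T v =ᵐ[μ] fun x => ∫ y, K x y * v y ∂ν := fun v => (hmem v).coeFn_toLp
  refine ⟨T.mkContinuous (measureUnivNNReal μ ^ (2 : ℝ≥0∞).toReal⁻¹ * C) fun v => ?_, fun v => ?_⟩
  · rw [mul_assoc]
    refine Lp.norm_le_of_ae_bound (by positivity) ?_
    filter_upwards [hbd v, hT v] with x h1 h2
    rw [h2]
    exact h1
  · filter_upwards [hint v, hT v] with x h1 h2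
    exact ⟨h1, h2⟩

end IntegralOperator

section Kernel

variable {d : ℕ}

/-- The weakly singular majorant of the Green's function is square integrable on balls. -/
theorem memLp_indicator_norm_rpow (hd : 2 ≤ d) (R : ℝ) :
    MemLp ((Metric.ball (0 : EuclideanSpace ℝ (Fin d)) R).indicator
      fun z => ‖z‖ ^ (-(((d : ℝ) - 1) / 2))) 2 volume := by
  have : Nonempty (Fin d) := ⟨⟨0, by omega⟩⟩
  have hmeas : Measurable fun z : EuclideanSpace ℝ (Fin d) => ‖z‖ ^ (-(((d : ℝ) - 1) / 2)) :=
    measurable_norm.pow_const _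
  rw [memLp_indicator_iff_restrict measurableSet_ball,
    memLp_two_iff_integrable_sq hmeas.aestronglyMeasurable]
  have h := (integrableOn_fun_norm_addHaar (volume : Measure (EuclideanSpace ℝ (Fin d)))
    (f := fun t : ℝ => (t ^ (-(((d : ℝ) - 1) / 2))) ^ 2) (r := R)).2 ?_
  · exact h
  · rw [finrank_euclideanSpace_fin]
    -- In polar coordinates the Jacobian t^(d-1) cancels the squared majorant exactly, leaving the
    -- constant 1.
    refine (integrableOn_const (C := (1 : ℝ)) (by simp)).congr_fun ?_ measurableSet_Ioo
    intro t ht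
    have ht0 : 0 < t := ht.1
    simp only [smul_eq_mul]
    rw [← Real.rpow_natCast, ← Real.rpow_natCast, ← Real.rpow_mul ht0.le, ← Real.rpow_add ht0,
      Nat.cast_sub (by omega)]
    push_cast
    ring_nf
    simp

variable {κ : ℝ} {m : EuclideanSpace ℝ (Fin d)} {F F1 F2 : ℂ → ℂ}

/-- The weighted profile has a limit at zero and is continuous, hence bounded on (0, R²]; the
comparison β²|z|² ≤ |z|_m² ≤ |z|² transfers the bound to the Euclidean norm. -/
theorem IsRadialProfile.exists_norm_le (hF : IsRadialProfile d κ F F1 F2) (hd : 2 ≤ d)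
    (hm : ‖m‖ < 1) (R : ℝ) :
    ∃ C : ℝ, 0 ≤ C ∧ ∀ z : EuclideanSpace ℝ (Fin d), z ≠ 0 → ‖z‖ < R →
      ‖F ((machBilin m z z : ℝ) : ℂ)‖ ≤ C * ‖z‖ ^ (-(((d : ℝ) - 1) / 2)) := by
  obtain ⟨c, hc⟩ := hF.tendsto_zero
  have hcont : ContinuousOn (fun s : ℝ => ((s ^ (((d : ℝ) - 1) / 4) : ℝ) : ℂ) * F s)
      (Set.Ioi 0) :=
    ContinuousOn.mul (continuous_ofReal.comp_continuousOn fun s hs =>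
      (Real.continuousAt_rpow_const s _ (Or.inl (ne_of_gt hs))).continuousWithinAt)
      (continuousOn_comp_ofReal hF.continuousOn)
  obtain ⟨C, hC0, hC⟩ := exists_bound_of_tendsto_nhdsGT_zero hcont hc (R * R)
  have hβ := betaSq_pos hm
  have hd' : (0 : ℝ) ≤ ((d : ℝ) - 1) / 4 := by
    have : (2 : ℝ) ≤ d := by exact_mod_cast hd
    linarith
  refine ⟨C * betaSq m ^ (-(((d : ℝ) - 1) / 4)), by positivity, fun z hz hzR => ?_⟩
  have hz0 := norm_pos_iff.2 hz
  have hs := machBilin_self_pos hm hz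
  have hsR : machBilin m z z ≤ R * R :=
    ((le_abs_self _).trans (abs_machBilin_le hm z z)).trans
      (mul_le_mul hzR.le hzR.le hz0.le (hz0.le.trans hzR.le))
  have h1 := hC _ hs hsR
  have hp : 0 < machBilin m z z ^ (((d : ℝ) - 1) / 4) := Real.rpow_pos_of_pos hs _
  rw [norm_mul, norm_real, Real.norm_of_nonneg hp.le] at h1
  have h2 : ‖F ((machBilin m z z : ℝ) : ℂ)‖ ≤ C * machBilin m z z ^ (-(((d : ℝ) - 1) / 4)) := by
    rw [Real.rpow_neg hs.le, ← div_eq_mul_inv, le_div_iff₀ hp, mul_comm]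
    exact h1
  refine h2.trans ?_
  rw [mul_assoc]
  refine mul_le_mul_of_nonneg_left ?_ hC0
  have h3 : betaSq m ^ (-(((d : ℝ) - 1) / 4)) * ‖z‖ ^ (-(((d : ℝ) - 1) / 2))
      = (betaSq m * ‖z‖ ^ 2) ^ (-(((d : ℝ) - 1) / 4)) := by
    rw [Real.mul_rpow hβ.le (by positivity), ← Real.rpow_natCast, ← Real.rpow_mul hz0.le]
    congr 2
    push_cast
    ring
  rw [h3]
  exact Real.rpow_le_rpow_of_nonpos (by positivity) (le_machBilin_self m z) (by linarith)

/-- Green's function in terms of a radial profile. -/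
theorem exists_green_eq (hd : d = 2 ∨ d = 3) {k : ℝ} (hk : 0 < k) (hm : ‖m‖ < 1) :
    ∃ (F F1 F2 : ℂ → ℂ) (c : ℂ), c ≠ 0 ∧ IsRadialProfile d (k / betaSq m) F F1 F2 ∧
      ∀ x y : EuclideanSpace ℝ (Fin d), x ≠ y → green k m x y
        = c * Complex.exp (-(I * (k / betaSq m * inner ℝ (x - y) m : ℝ)))
          * F ((machBilin m (x - y) (x - y) : ℝ) : ℂ) := by
  have hβ := betaSq_pos hm
  have hκ : 0 < k / betaSq m := div_pos hk hβ
  rcases hd with rfl | rfl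
  · obtain ⟨F, F1, F2, hF, hH⟩ := exists_radialProfile_two hκ
    refine ⟨F, F1, F2, I / (4 * (Real.sqrt (betaSq m) : ℂ)), ?_, hF, fun x y hxy => ?_⟩
    · have : ((Real.sqrt (betaSq m) : ℝ) : ℂ) ≠ 0 := by exact_mod_cast (Real.sqrt_pos.2 hβ).ne'
      exact div_ne_zero I_ne_zero (mul_ne_zero (by norm_num) this)
    · have h := hH _ (machNorm_pos hm (sub_ne_zero.2 hxy))
      rw [machNorm_sq hm] at h
      rw [green, if_pos rfl, green2, h]
  · obtain ⟨F, F1, F2, hF, hH⟩ := exists_radialProfile_three (k / betaSq m)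
    refine ⟨F, F1, F2, 1 / (4 * (Real.pi : ℂ)), ?_, hF, fun x y hxy => ?_⟩
    · have : (Real.pi : ℂ) ≠ 0 := by exact_mod_cast Real.pi_ne_zero
      exact div_ne_zero one_ne_zero (mul_ne_zero (by norm_num) this)
    · have h := hH _ (machNorm_pos hm (sub_ne_zero.2 hxy))
      rw [machNorm_sq hm] at h
      rw [green, if_neg (by norm_num), green3, ← h, mul_add, ofReal_add, mul_add, Complex.exp_add,
        mul_neg, ofReal_neg, mul_neg]
      ring

/-- The volume potential is a bounded operator from `L²(Ω)` to `L²(M)`. -/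
theorem exists_isVolumePotentialOperator (hd : d = 2 ∨ d = 3)
    {Ω M : Set (EuclideanSpace ℝ (Fin d))} (hΩ : IsOpen Ω) (hΩb : Bornology.IsBounded Ω)
    (hM : IsOpen M) (hMb : Bornology.IsBounded M) (hMs : M ⊆ (closure Ω)ᶜ)
    {k : ℝ} (hk : 0 < k) (hm : ‖m‖ < 1) :
    ∃ G : L2 Ω →L[ℂ] L2 M, IsVolumePotentialOperator k m Ω M G := by
  obtain ⟨F, F1, F2, c, -, hF, hgreen⟩ := exists_green_eq hd hk hm
  have hd2 : 2 ≤ d := by omega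
  have hne : ∀ x ∈ M, ∀ y ∈ Ω, x ≠ y := fun x hx y hy h => hMs hx (h ▸ subset_closure hy)
  obtain ⟨R₁, hR₁⟩ := hΩb.exists_norm_le
  obtain ⟨R₂, hR₂⟩ := hMb.exists_norm_le
  set R : ℝ := R₂ + R₁ + 1 with hR
  have hlt : ∀ x ∈ M, ∀ y ∈ Ω, ‖x - y‖ < R := fun x hx y hy =>
    (norm_sub_le x y).trans_lt (by rw [hR]; linarith [hR₁ y hy, hR₂ x hx])
  obtain ⟨C, hC0, hC⟩ := hF.exists_norm_le hd2 hm R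
  have hg : MemLp (fun z => (‖c‖ * C) * (Metric.ball (0 : EuclideanSpace ℝ (Fin d)) R).indicator
      (fun z => ‖z‖ ^ (-(((d : ℝ) - 1) / 2))) z) 2 volume :=
    (memLp_indicator_norm_rpow hd2 R).const_mul _
  set g : EuclideanSpace ℝ (Fin d) → ℝ := fun z => (‖c‖ * C) *
    (Metric.ball (0 : EuclideanSpace ℝ (Fin d)) R).indicator
      (fun z => ‖z‖ ^ (-(((d : ℝ) - 1) / 2))) z with hgdef
  have hgreen_cont : ContinuousOn
      (Function.uncurry fun x y : EuclideanSpace ℝ (Fin d) => green k m x y) (M ×ˢ Ω) := by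
    have h1 : ContinuousOn (fun z : EuclideanSpace ℝ (Fin d) × EuclideanSpace ℝ (Fin d) =>
        c * Complex.exp (-(I * (k / betaSq m * inner ℝ (z.1 - z.2) m : ℝ)))
          * F ((machBilin m (z.1 - z.2) (z.1 - z.2) : ℝ) : ℂ)) (M ×ˢ Ω) := by
      refine ContinuousOn.mul (Continuous.continuousOn (by fun_prop)) ?_
      exact (continuousOn_comp_machBilin_sub hF.continuousOn hm).mono
        fun z hz => hne z.1 hz.1 z.2 hz.2
    exact h1.congr fun z hz => hgreen z.1 z.2 (hne z.1 hz.1 z.2 hz.2)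
  have hbound : ∀ x ∈ M, ∀ y ∈ Ω, ‖green k m x y‖ ≤ ‖g (x - y)‖ := by
    intro x hx y hy
    have hxy := hne x hx y hy
    have h1 : ‖Complex.exp (-(I * (k / betaSq m * inner ℝ (x - y) m : ℝ)))‖ = 1 := by
      rw [← mul_neg, ← ofReal_neg, mul_comm, Complex.norm_exp_ofReal_mul_I]
    rw [hgreen x y hxy, norm_mul, norm_mul, h1, mul_one, hgdef]
    simp only []
    rw [Set.indicator_of_mem (mem_ball_zero_iff.2 (hlt x hx y hy)), norm_mul, norm_mul, norm_norm,
      Real.norm_of_nonneg hC0, mul_assoc, Real.norm_of_nonneg (Real.rpow_nonneg (norm_nonneg _) _)]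
    exact mul_le_mul_of_nonneg_left (hC _ (sub_ne_zero.2 hxy) (hlt x hx y hy)) (norm_nonneg _)
  have hfin : IsFiniteMeasure (volume.restrict M) := ⟨by
    rw [Measure.restrict_apply_univ]; exact hMb.measure_lt_top⟩
  -- M may touch the boundary of Ω, so the kernel need not be bounded. Translation and reflection
  -- invariance of Lebesgue measure make the L² norm of the majorant independent of x.
  have key : ∀ x ∈ M, MemLp (green k m x) 2 (volume.restrict Ω) ∧
      eLpNorm (green k m x) 2 (volume.restrict Ω) ≤ ((eLpNorm g 2 volume).toNNReal : ENNReal) := by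
    intro x hx
    have hmeas : AEStronglyMeasurable (green k m x) (volume.restrict Ω) := by
      have hc : ContinuousOn (fun y : EuclideanSpace ℝ (Fin d) => (x, y)) Ω := by fun_prop
      have h := ContinuousOn.comp (f := fun y : EuclideanSpace ℝ (Fin d) => (x, y)) hgreen_cont hc
        fun y hy => ⟨hx, hy⟩
      exact h.aestronglyMeasurable hΩ.measurableSet
    have hle : eLpNorm (green k m x) 2 (volume.restrict Ω) ≤ eLpNorm g 2 volume := by
      calc eLpNorm (green k m x) 2 (volume.restrict Ω)
          ≤ eLpNorm (g ∘ fun y => x - y) 2 (volume.restrict Ω) :=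
            eLpNorm_mono_ae ((ae_restrict_iff' hΩ.measurableSet).2
              (Eventually.of_forall fun y hy => hbound x hx y hy))
        _ ≤ eLpNorm (g ∘ fun y => x - y) 2 volume :=
            eLpNorm_mono_measure _ Measure.restrict_le_self
        _ = eLpNorm g 2 volume :=
            eLpNorm_comp_measurePreserving hg.aestronglyMeasurable
              (Measure.measurePreserving_sub_left volume x)
    refine ⟨⟨hmeas, hle.trans_lt hg.eLpNorm_lt_top⟩, ?_⟩
    rwa [ENNReal.coe_toNNReal hg.eLpNorm_ne_top]
  exact exists_integralOperator (μ := volume.restrict M) (ν := volume.restrict Ω)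
    (K := green k m)
    (by
      rw [Measure.prod_restrict]
      exact hgreen_cont.aestronglyMeasurable (hM.measurableSet.prod hΩ.measurableSet))
    ((ae_restrict_iff' hM.measurableSet).2 (Eventually.of_forall key))

end Kernel

end ConvectedHelmholtz

/-! ### Plane waves as superpositions of exterior sources -/

namespace ConvectedHelmholtz

open Filter Topology Complex
open scoped ContDiff

variable {d : ℕ} {κ : ℝ} {m : EuclideanSpace ℝ (Fin d)}

/-- The plane wave `exp(-i κ (A x̂)·y)`. -/
noncomputable def machWave (κ : ℝ) (m xhat y : EuclideanSpace ℝ (Fin d)) : ℂ :=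
  Complex.exp (-(I * κ) * ((inner ℝ (machA m xhat) y : ℝ) : ℂ))

theorem contDiff_machWave (xhat : EuclideanSpace ℝ (Fin d)) : ContDiff ℝ ∞ (machWave κ m xhat) :=
  Complex.contDiff_exp.comp (contDiff_const.mul
    (ofRealCLM.contDiff.comp (contDiff_const.inner ℝ contDiff_id)))

theorem fderiv_machWave (xhat x b : EuclideanSpace ℝ (Fin d)) :
    fderiv ℝ (machWave κ m xhat) x b
      = -(I * κ) * ((machBilin m xhat b : ℝ) : ℂ) * machWave κ m xhat x := by
  have hd : DifferentiableAt ℝ (machWave κ m xhat) x :=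
    (contDiff_machWave xhat).differentiable (by simp) x
  have h1 := hd.hasFDerivAt.hasLineDerivAt b
  have h2 : HasLineDerivAt ℝ (machWave κ m xhat)
      (-(I * κ) * ((machBilin m xhat b : ℝ) : ℂ) * machWave κ m xhat x) x b := by
    have h3 : HasDerivAt (fun t : ℝ => inner ℝ (machA m xhat) x + t * machBilin m xhat b)
        (machBilin m xhat b) 0 := by
      simpa using ((hasDerivAt_id (0 : ℝ)).mul_const (machBilin m xhat b)).const_add
        (inner ℝ (machA m xhat) x)
    have h4 := (h3.ofReal_comp.const_mul (-(I * κ))).cexp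
    simp only [zero_mul, add_zero] at h4
    rw [mul_comm]
    have h5 : (fun t : ℝ => machWave κ m xhat (x + t • b)) = fun t : ℝ =>
        Complex.exp (-(I * κ) * ((inner ℝ (machA m xhat) x + t * machBilin m xhat b : ℝ) : ℂ)) := by
      funext t
      rw [machWave, inner_add_right, real_inner_smul_right, inner_machA m xhat b]
    change HasDerivAt (fun t : ℝ => machWave κ m xhat (x + t • b)) _ 0
    rw [h5]
    exact h4
  exact HasDerivAt.unique h1 h2

/-- Second derivatives along b multiply the wave by -κ² times the squared Mach form of x̂ and b. On
the Mach sphere they combine to -κ²β², cancelling the zero-order term. -/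
theorem convOp_machWave {xhat : EuclideanSpace ℝ (Fin d)} (hx : machBilin m xhat xhat = 1)
    (x : EuclideanSpace ℝ (Fin d)) : convOp κ m (machWave κ m xhat) x = 0 := by
  have h2 : ∀ b, lineDeriv₂ b (machWave κ m xhat) x
      = -(κ ^ 2) * ((machBilin m xhat b : ℝ) : ℂ) ^ 2 * machWave κ m xhat x := by
    intro b
    rw [lineDeriv₂]
    simp only [fderiv_machWave]
    rw [fderiv_const_mul ((contDiff_machWave xhat).differentiable (by simp) x)]
    simp only [smul_apply, fderiv_machWave, smul_eq_mul]
    linear_combination (κ : ℂ) ^ 2 * ((machBilin m xhat b : ℝ) : ℂ) ^ 2 * machWave κ m xhat x * I_sq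
  have e1 := congrArg (fun t : ℝ => (t : ℂ)) (sum_machBilin_single_sq m xhat)
  simp only [convOp, h2]
  rw [← Finset.sum_mul, ← Finset.mul_sum]
  rw [hx] at e1
  push_cast at e1
  linear_combination -(κ ^ 2) * machWave κ m xhat x * e1

/-- A density whose potential vanishes outside the closure of its support is orthogonal to all
plane waves. -/
theorem IsRadialProfile.integral_machWave_eq_zero {F F1 F2 : ℂ → ℂ}
    (hF : IsRadialProfile d κ F F1 F2) (hm : ‖m‖ < 1) {Ω : Set (EuclideanSpace ℝ (Fin d))}
    (hΩ : IsOpen Ω) (hb : Bornology.IsBounded Ω) {v : EuclideanSpace ℝ (Fin d) → ℂ}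
    (hv : IntegrableOn v Ω)
    (h0 : ∀ x ∈ (closure Ω)ᶜ,
      ∫ y in Ω, F ((machBilin m (x - y) (x - y) : ℝ) : ℂ) * v y = 0)
    {xhat : EuclideanSpace ℝ (Fin d)} (hx : machBilin m xhat xhat = 1) :
    ∫ y in Ω, machWave κ m xhat y * v y = 0 := by
  obtain ⟨K, hK0, hK⟩ := hF.exists_integral_eq hm
  obtain ⟨R₀, hR₀⟩ := hb.closure.exists_norm_le
  set R : ℝ := |R₀| + 1 with hR
  have hR0 : 0 < R := by positivity
  have hsub : closure Ω ⊆ Metric.ball 0 R := fun y hy => by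
    rw [mem_ball_zero_iff, hR]
    linarith [hR₀ y hy, le_abs_self R₀]
  -- The cut-off equals one on a ball containing the closure of Ω, so applying the operator to φ
  -- gives a source supported outside that ball.
  let χ : ContDiffBump (0 : EuclideanSpace ℝ (Fin d)) := ⟨R, R + 1, hR0, by linarith⟩
  set φ : EuclideanSpace ℝ (Fin d) → ℂ := fun x => (χ x : ℂ) * machWave κ m xhat x with hφdef
  have hφ : ContDiff ℝ ∞ φ := (ofRealCLM.contDiff.comp χ.contDiff).mul (contDiff_machWave xhat)
  have hφc : HasCompactSupport φ :=
    HasCompactSupport.mul_right (χ.hasCompactSupport.comp_left (g := fun t : ℝ => (t : ℂ)) (by simp))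
  have hφ1 : ∀ y ∈ Metric.ball (0 : EuclideanSpace ℝ (Fin d)) R, φ y = machWave κ m xhat y := by
    intro y hy
    rw [hφdef]
    simp only []
    rw [χ.one_of_mem_closedBall (Metric.ball_subset_closedBall hy), ofReal_one, one_mul]
  have hψ0 : ∀ y ∈ Metric.ball (0 : EuclideanSpace ℝ (Fin d)) R, convOp κ m φ y = 0 := by
    intro y hy
    rw [convOp_congr (Filter.eventually_of_mem (Metric.isOpen_ball.mem_nhds hy) hφ1)]
    exact convOp_machWave hx y
  set ψ := convOp κ m φ with hψ
  have hψc : Continuous ψ := continuous_convOp hφ κ m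
  have hψs : HasCompactSupport ψ := hasCompactSupport_convOp hφc κ m
  set S : Set (EuclideanSpace ℝ (Fin d)) := tsupport ψ \ Metric.ball 0 R with hS
  have hSc : IsCompact S := hψs.isCompact.diff Metric.isOpen_ball
  have hSm : MeasurableSet S := hSc.measurableSet
  have hS0 : ∀ x, x ∉ S → ψ x = 0 := by
    intro x hxS
    by_cases hxb : x ∈ Metric.ball 0 R
    · exact hψ0 x hxb
    · exact image_eq_zero_of_notMem_tsupport fun h => hxS ⟨h, hxb⟩
  have hSΩ : S ⊆ (closure Ω)ᶜ := fun x hxS hxΩ => hxS.2 (hsub hxΩ)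
  -- On Ω the plane wave is K⁻¹ times a superposition of kernels with poles in the compact exterior
  -- set S.
  have hrep : ∀ y ∈ Ω, ∫ x in S, F ((machBilin m (x - y) (x - y) : ℝ) : ℂ) * ψ x
      = K * machWave κ m xhat y := by
    intro y hy
    have hyb := hsub (subset_closure hy)
    rw [setIntegral_eq_integral_of_forall_compl_eq_zero fun x hx => by rw [hS0 x hx, mul_zero],
      ← hφ1 y hyb]
    exact hK φ y hφ hφc (Filter.eventually_of_mem (Metric.isOpen_ball.mem_nhds hyb) hψ0)
  have hcont : ContinuousOn (fun z : EuclideanSpace ℝ (Fin d) × EuclideanSpace ℝ (Fin d) =>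
      F ((machBilin m (z.2 - z.1) (z.2 - z.1) : ℝ) : ℂ)) (closure Ω ×ˢ S) := by
    have h := ContinuousOn.comp (f := fun z : EuclideanSpace ℝ (Fin d) × EuclideanSpace ℝ (Fin d) =>
      (z.2, z.1)) (continuousOn_comp_machBilin_sub hF.continuousOn hm)
      (s := closure Ω ×ˢ S) (by fun_prop) fun z hz h => hSΩ hz.2 (by
        have : z.2 = z.1 := h
        rw [this]; exact hz.1)
    exact h
  obtain ⟨C, hC⟩ := (hb.isCompact_closure.prod hSc).exists_bound_of_continuousOn hcont
  have hprod : Integrable (fun z : EuclideanSpace ℝ (Fin d) × EuclideanSpace ℝ (Fin d) =>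
      F ((machBilin m (z.2 - z.1) (z.2 - z.1) : ℝ) : ℂ) * (v z.1 * ψ z.2))
      ((volume.restrict Ω).prod (volume.restrict S)) := by
    refine Integrable.bdd_mul (c := C)
      (hv.mul_prod (hψc.integrable_of_hasCompactSupport hψs).integrableOn) ?_ ?_
    · rw [Measure.prod_restrict]
      exact (hcont.mono (Set.prod_mono subset_closure subset_rfl)).aestronglyMeasurable
        (hΩ.measurableSet.prod hSm)
    · rw [Measure.prod_restrict]
      exact (ae_restrict_iff' (hΩ.measurableSet.prod hSm)).2 (Eventually.of_forall fun z hz =>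
        hC z ⟨subset_closure hz.1, hz.2⟩)
  have hswap := integral_integral_swap (f := fun y x : EuclideanSpace ℝ (Fin d) =>
    F ((machBilin m (x - y) (x - y) : ℝ) : ℂ) * (v y * ψ x)) hprod
  have hl : ∫ y in Ω, ∫ x in S, F ((machBilin m (x - y) (x - y) : ℝ) : ℂ) * (v y * ψ x)
      = K * ∫ y in Ω, machWave κ m xhat y * v y := by
    rw [← integral_const_mul]
    refine setIntegral_congr_fun hΩ.measurableSet fun y hy => ?_
    rw [← mul_assoc, ← hrep y hy, ← integral_mul_const]
    refine integral_congr_ae (Eventually.of_forall fun x => ?_)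
    simp only []
    ring
  -- After the swap the inner integral is the potential of v at an exterior point, times ψ(x).
  have hr : ∫ x in S, ∫ y in Ω, F ((machBilin m (x - y) (x - y) : ℝ) : ℂ) * (v y * ψ x) = 0 := by
    refine setIntegral_eq_zero_of_forall_eq_zero fun x hxS => ?_
    simp only [← mul_assoc]
    rw [integral_mul_const, h0 x (hSΩ hxS), zero_mul]
  rw [hl, hr] at hswap
  exact (mul_eq_zero.1 hswap).resolve_left hK0

theorem continuous_planeWave (k : ℝ) (m xhat : EuclideanSpace ℝ (Fin d)) :
    Continuous (planeWave k m xhat) := by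
  unfold planeWave
  fun_prop

theorem memLp_planeWave (k : ℝ) (m xhat : EuclideanSpace ℝ (Fin d))
    {Ω : Set (EuclideanSpace ℝ (Fin d))} (hb : Bornology.IsBounded Ω) :
    MemLp (planeWave k m xhat) 2 (volume.restrict Ω) := by
  have hfin : IsFiniteMeasure (volume.restrict Ω) := ⟨by
    rw [Measure.restrict_apply_univ]; exact hb.measure_lt_top⟩
  refine MemLp.of_bound (continuous_planeWave k m xhat).aestronglyMeasurable 1
    (Eventually.of_forall fun y => ?_)
  rw [planeWave, mul_comm, Complex.norm_exp_ofReal_mul_I]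

theorem isVolumePotentialOperator_unique {k : ℝ} {Ω M : Set (EuclideanSpace ℝ (Fin d))}
    {G G' : L2 Ω →L[ℂ] L2 M} (hG : IsVolumePotentialOperator k m Ω M G)
    (hG' : IsVolumePotentialOperator k m Ω M G') : G = G' := by
  ext1 v
  refine Lp.ext ?_
  filter_upwards [hG v, hG' v] with x h1 h2
  rw [h1.2, h2.2]

/-- Plane waves are orthogonal to the kernel of the volume potential operator. -/
theorem inner_planeWave_eq_zero (hd : d = 2 ∨ d = 3) {Ω M : Set (EuclideanSpace ℝ (Fin d))}
    (hΩ : IsOpen Ω) (hb : Bornology.IsBounded Ω) (hcompl : IsPreconnected (closure Ω)ᶜ)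
    (hM : IsOpen M) (hMn : M.Nonempty) (hMs : M ⊆ (closure Ω)ᶜ) {k : ℝ} (hk : 0 < k)
    (hm : ‖m‖ < 1) {G : L2 Ω →L[ℂ] L2 M} (hG : IsVolumePotentialOperator k m Ω M G)
    {xhat : EuclideanSpace ℝ (Fin d)} (hx : xhat ∈ machSphere m) {v : L2 Ω} (hv : G v = 0)
    (hu : MemLp (planeWave k m xhat) 2 (volume.restrict Ω)) :
    inner ℂ (hu.toLp (planeWave k m xhat)) v = 0 := by
  obtain ⟨F, F1, F2, c, hc, hF, hgreen⟩ := exists_green_eq hd hk hm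
  have hfin : IsFiniteMeasure (volume.restrict Ω) := ⟨by
    rw [Measure.restrict_apply_univ]; exact hb.measure_lt_top⟩
  have hx' : machBilin m xhat xhat = 1 := by
    have h : machNorm m xhat = 1 := hx
    rw [← machNorm_sq hm, h, one_pow]
  set κ : ℝ := k / betaSq m with hκ
  -- The y-part of the convective phase goes into the density; the x-part is a nonvanishing factor
  -- outside the integral.
  let w : EuclideanSpace ℝ (Fin d) → ℂ := fun y => Complex.exp ((κ * inner ℝ y m : ℝ) * I) * v y
  have hvi : IntegrableOn v Ω := (Lp.memLp v).integrable (by norm_num)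
  have hw : IntegrableOn w Ω := by
    refine Integrable.bdd_mul (c := 1) hvi (Continuous.aestronglyMeasurable (by fun_prop))
      (Eventually.of_forall fun y => ?_)
    rw [Complex.norm_exp_ofReal_mul_I]
  have h0 : ∀ᵐ x ∂volume.restrict M,
      ∫ y in Ω, F ((machBilin m (x - y) (x - y) : ℝ) : ℂ) * w y = 0 := by
    have hGv : G v =ᵐ[volume.restrict M] 0 := by
      rw [hv]; exact Lp.coeFn_zero ℂ 2 _
    filter_upwards [hG v, hGv, ae_restrict_mem hM.measurableSet] with x h1 h2 hxM
    have h3 : ∫ y in Ω, green k m x y * v y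
        = c * Complex.exp (-(I * (κ * inner ℝ x m : ℝ))) *
          ∫ y in Ω, F ((machBilin m (x - y) (x - y) : ℝ) : ℂ) * w y := by
      rw [← integral_const_mul]
      refine setIntegral_congr_fun hΩ.measurableSet fun y hy => ?_
      have hxy : x ≠ y := fun h => hMs hxM (h ▸ subset_closure hy)
      have h4 : Complex.exp (-(I * (κ * inner ℝ (x - y) m : ℝ)))
          = Complex.exp (-(I * (κ * inner ℝ x m : ℝ))) * Complex.exp ((κ * inner ℝ y m : ℝ) * I) := by
        rw [← Complex.exp_add, inner_sub_left]
        congr 1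
        push_cast
        ring
      simp only [w]
      rw [hgreen x y hxy, h4]
      ring
    rw [← h1.2, h2, Pi.zero_apply] at h3
    exact (mul_eq_zero.1 h3.symm).resolve_left (mul_ne_zero hc (Complex.exp_ne_zero _))
  have hfinal := hF.integral_machWave_eq_zero hm hΩ hb hw
    (fun x hx => hF.potential_eq_zero hm hΩ hb hcompl hM hMn hMs hw h0 hx) hx'
  rw [L2.inner_def, ← hfinal]
  refine integral_congr_ae ?_
  filter_upwards [hu.coeFn_toLp] with y hy
  -- The inner product conjugates its first argument, and the term -m in the exponent of u becomes
  -- exactly the phase that turns v into w.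
  have h5 : (starRingEnd ℂ) (planeWave k m xhat y)
      = machWave κ m xhat y * Complex.exp ((κ * inner ℝ y m : ℝ) * I) := by
    rw [planeWave, ← hκ, machWave, ← Complex.exp_conj, ← Complex.exp_add, map_mul, conj_I, conj_ofReal,
      inner_sub_left, real_inner_comm y m]
    congr 1
    push_cast
    ring
  rw [hy, RCLike.inner_apply, h5]
  simp only [w]
  ring

end ConvectedHelmholtz

theorem proposition4 (d : ℕ) (hd : d = 2 ∨ d = 3)
    (Ω M : Set (EuclideanSpace ℝ (Fin d)))
    (hΩ_open : IsOpen Ω) (hΩ_conn : IsConnected Ω) (hΩ_bdd : Bornology.IsBounded Ω)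
    (hΩ_zero : (0 : EuclideanSpace ℝ (Fin d)) ∈ Ω)
    (hΩ_compl : IsConnected (closure Ω)ᶜ)
    (hM_open : IsOpen M) (hM_conn : IsConnected M) (hM_bdd : Bornology.IsBounded M)
    (hM_sub : M ⊆ (closure Ω)ᶜ)
    (k : ℝ) (hk : 0 < k) (m : EuclideanSpace ℝ (Fin d)) (hm : ‖m‖ < 1) :
    (∃! G : ConvectedHelmholtz.L2 Ω →L[ℂ] ConvectedHelmholtz.L2 M,
      ConvectedHelmholtz.IsVolumePotentialOperator k m Ω M G) ∧
    ∀ G : ConvectedHelmholtz.L2 Ω →L[ℂ] ConvectedHelmholtz.L2 M,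
      ConvectedHelmholtz.IsVolumePotentialOperator k m Ω M G →
      ∀ xhat ∈ ConvectedHelmholtz.machSphere m,
        ∃ hu : MemLp (ConvectedHelmholtz.planeWave k m xhat) 2 (volume.restrict Ω),
          hu.toLp (ConvectedHelmholtz.planeWave k m xhat)
              ∈ closure (Set.range (ContinuousLinearMap.adjoint G)) ∧
          hu.toLp (ConvectedHelmholtz.planeWave k m xhat)
              ∈ (LinearMap.ker (G : ConvectedHelmholtz.L2 Ω →ₗ[ℂ] ConvectedHelmholtz.L2 M))ᗮ := by
  refine ⟨?_, fun G hG xhat hx => ?_⟩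
  · obtain ⟨G, hG⟩ := ConvectedHelmholtz.exists_isVolumePotentialOperator hd hΩ_open hΩ_bdd hM_open
      hM_bdd hM_sub hk hm
    exact ⟨G, hG, fun G' hG' => ConvectedHelmholtz.isVolumePotentialOperator_unique hG' hG⟩
  · have hu := ConvectedHelmholtz.memLp_planeWave k m xhat hΩ_bdd
    have horth : hu.toLp (ConvectedHelmholtz.planeWave k m xhat)
        ∈ (LinearMap.ker (G : ConvectedHelmholtz.L2 Ω →ₗ[ℂ] ConvectedHelmholtz.L2 M))ᗮ := by
      rw [Submodule.mem_orthogonal']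
      intro v hv
      exact ConvectedHelmholtz.inner_planeWave_eq_zero hd hΩ_open hΩ_bdd
        hΩ_compl.isPreconnected hM_open hM_conn.nonempty hM_sub hk hm hG hx (LinearMap.mem_ker.1 hv) hu
    refine ⟨hu, ?_, horth⟩
    -- In Hilbert space the orthogonal complement of the kernel is the closure of the range of the
    -- adjoint.
    have h := horth
    rw [ContinuousLinearMap.orthogonal_ker, ← SetLike.mem_coe,
      Submodule.topologicalClosure_coe] at h
    exact h
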